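/- **Definitions.** For $x\in\mathbb R^p$, $\|x\|_0$ is the number of nonzero entries of $x$, $\|\cdot\|$ is the Euclidean norm, and $\mathbf e\in\mathbb R^m$ is the all-ones vector. A function $f:\mathbb N\to\mathbb R$ is in $p^{\Omega(1)}$ if there is $c>0$ with $f(p)\ge p^{c}$ for all sufficiently large $p$. A BPP algorithm is a randomized algorithm that runs in polynomial time; it *distinguishes* two cases if it accepts every input in the first case with probability at least $2/3$ and every input in the second case with probability at most $1/3$. A *two-prover MIP* for SAT consists of, for each input $\varphi$, finite sets $R,Q_1,Q_2,A_1,A_2$ with $R,A_1,A_2$ nonempty, questions $q_1:R\to Q_1$ and $q_2:R\to Q_2$, and a verdict $V:R\times A_1\times A_2\to\{0,1\}$, where the sizes of the sets, the questions and the verdict are computable in polynomial time. For strategies $P_i:Q_i\to A_i$ the acceptance probability is $\Pr_{r\in R}[V(r,P_1(q_1(r)),P_2(q_2(r)))=1]$ with $r$ uniform in $R$. It has *perfect completeness* if for every $\varphi\in\mathrm{SAT}$ some pair of strategies is accepted with probability $1$, and *soundness error at most $\epsilon$* if for every $\varphi\notin\mathrm{SAT}$ every pair of strategies is accepted with probability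 at most $\epsilon$. It satisfies *functionality* if for all $r,a_1$ there is at most one $a_2$ with $V(r,a_1,a_2)=1$, and *uniformity* if, for uniform $r$, $q_i(r)$ is uniformly distributed on $Q_i$ for $i=1,2$. **Biregular PGC.** There are $c>0$ and a polynomial bound $\mathrm{poly}(\cdot,\cdot)$ such that for every $\epsilon=\epsilon(N)>0$ with $\epsilon(N)\ge 1/N^{c}$ there is a two-prover MIP for SAT, satisfying functionality and uniformity, which on instances of size $N$ has perfect completeness, soundness error at most $\epsilon(N)$, and $|R|,|Q_1|,|Q_2|,|A_1|,|A_2|\le \mathrm{poly}(N,1/\epsilon(N))$. **Proposition.** Assume the Biregular PGC. Then there are $\sigma=\sigma(p)$ and $\Delta=\Delta(p)$, both in $p^{\Omega(1)}$, such that the following holds. If $\mathrm{SAT}\notin\mathrm{BPP}$, then there are a polynomial $m=m(p)$ and a positive integer $k=k(p)$, computable in time polynomial in $p$, such that no BPP algorithm, given a Boolean matrix $B$ of size $m(p)\times p$, distinguishes the following two cases, even if it only has to do so for all sufficiently large $p$: 1. there is $x\in\{0,1\}^p$ with $Bx=\mathbf e$ and $\|x\|_0\le k(p)$; 2. every $x\in\mathbb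 R^p$ with $\|Bx-\mathbf e\|^2\le\Delta(p)$ satisfies $\|x\|_0\ge k(p)\,\sigma(p)$. -/

import Mathlib

namespace SparseReg

/-! ## Machine model

Structured programs over registers that are stacks of bits.  Every elementary instruction inspects or
changes only the top of one stack and costs one step, so that a program is a multi-tape Turing machine
with structured control. -/

/-- Programs.  A program mentions finitely many of the registers `0, 1, 2, …`. -/
inductive Prog : Type where
  | skip : Prog
  | push (i : ℕ) (b : Bool) : Prog
  | pop (i : ℕ) : Prog
  | seq (P Q : Prog) : Prog
  /-- Three-way branch on register `i`: empty / top bit `false` / top bit `true`. -/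
  | branch (i : ℕ) (Pe Pf Pt : Prog) : Prog
  /-- Repeat the body as long as register `i` is nonempty. -/
  | loop (i : ℕ) (P : Prog) : Prog

/-- The contents of the registers; the head of a list is the top of the stack. -/
abbrev Regs : Type := ℕ → List Bool

/-- `Exec P s t s'`: program `P`, started with register contents `s`, halts after exactly `t` steps
with register contents `s'`. -/
inductive Exec : Prog → Regs → ℕ → Regs → Prop where
  | skip (s : Regs) : Exec Prog.skip s 1 s
  | push (i : ℕ) (b : Bool) (s : Regs) :
      Exec (Prog.push i b) s 1 (Function.update s i (b :: s i))
  | pop (i : ℕ) (s : Regs) :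
      Exec (Prog.pop i) s 1 (Function.update s i (s i).tail)
  | seq {P Q : Prog} {s s' s'' : Regs} {t t' : ℕ} :
      Exec P s t s' → Exec Q s' t' s'' → Exec (Prog.seq P Q) s (t + t') s''
  | branch_empty {i : ℕ} {Pe Pf Pt : Prog} {s s' : Regs} {t : ℕ} :
      s i = [] → Exec Pe s t s' → Exec (Prog.branch i Pe Pf Pt) s (t + 1) s'
  | branch_false {i : ℕ} {Pe Pf Pt : Prog} {s s' : Regs} {t : ℕ} :
      (s i).head? = some false → Exec Pf s t s' → Exec (Prog.branch i Pe Pf Pt) s (t + 1) s'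
  | branch_true {i : ℕ} {Pe Pf Pt : Prog} {s s' : Regs} {t : ℕ} :
      (s i).head? = some true → Exec Pt s t s' → Exec (Prog.branch i Pe Pf Pt) s (t + 1) s'
  | loop_done {i : ℕ} {P : Prog} {s : Regs} :
      s i = [] → Exec (Prog.loop i P) s 1 s
  | loop_step {i : ℕ} {P : Prog} {s s' s'' : Regs} {t t' : ℕ} :
      s i ≠ [] → Exec P s t s' → Exec (Prog.loop i P) s' t' s'' →
        Exec (Prog.loop i P) s (t + t' + 1) s''

/-- Initial registers: the inputs in registers `0, 1, …`, all others empty. -/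
def load (inputs : List (List Bool)) : Regs := fun i => inputs.getD i []

/-- A natural number in unary. -/
def unary (n : ℕ) : List Bool := List.replicate n true

/-- Total length of a list of inputs. -/
def inputSize (inputs : List (List Bool)) : ℕ := (inputs.map List.length).sum

/-- Some program computes, for every `a : α`, the string `out a` (in register `0`) from the strings
`inp a`, in time polynomial in the total length of `inp a`. -/
def PolyTime {α : Type} (inp : α → List (List Bool)) (out : α → List Bool) : Prop :=
  ∃ (P : Prog) (τ : Polynomial ℕ), ∀ a : α, ∃ (t : ℕ) (s : Regs),
    Exec P (load (inp a)) t s ∧ s 0 = out a ∧ t ≤ τ.eval (inputSize (inp a))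

/-! ## Bounded-error probabilistic polynomial time -/

/-- On input `x` and random string `w`, the program halts with the output `1`. -/
def Accepts (P : Prog) (x w : List Bool) : Prop :=
  ∃ (t : ℕ) (s : Regs), Exec P (load [x, w]) t s ∧ s 0 = [true]

open Classical in
/-- The probability that `P` accepts `x`, over a uniformly random string of `n` bits. -/
noncomputable def acceptProb (P : Prog) (n : ℕ) (x : List Bool) : ℝ :=
  ((Finset.univ.filter fun w : Fin n → Bool => Accepts P x (List.ofFn w)).card : ℝ) / 2 ^ n

/-- Some randomized algorithm distinguishes the inputs in `yes` from the inputs in `no`, with two-sided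
error at most `1/3`, using polynomially many random bits and polynomial time. -/
def BPPDistinguishable (yes no : Set (List Bool)) : Prop :=
  ∃ (P : Prog) (ρ τ : Polynomial ℕ),
    (∀ x ∈ yes ∪ no, ∀ w : Fin (ρ.eval x.length) → Bool, ∃ (t : ℕ) (s : Regs),
      Exec P (load [x, List.ofFn w]) t s ∧ t ≤ τ.eval x.length) ∧
    (∀ x ∈ yes, 2 / 3 ≤ acceptProb P (ρ.eval x.length) x) ∧
    (∀ x ∈ no, acceptProb P (ρ.eval x.length) x ≤ 1 / 3)

/-- The complexity class BPP. -/
def BPP : Set (Set (List Bool)) := {L | BPPDistinguishable L Lᶜ}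

/-! ## SAT -/

/-- A literal: a variable and its required truth value. -/
abbrev Literal : Type := ℕ × Bool

/-- A formula in conjunctive normal form, as a list of clauses. -/
abbrev CNF : Type := List (List Literal)

def CNF.Satisfiable (φ : CNF) : Prop :=
  ∃ v : ℕ → Bool, ∀ C ∈ φ, ∃ l ∈ C, v l.1 = l.2

/-- Self-delimiting binary encoding of a natural number. -/
def encodeNat (n : ℕ) : List Bool := (Nat.bits n).flatMap (fun b => [true, b]) ++ [false]

def encodeLiteral (l : Literal) : List Bool := encodeNat l.1 ++ [l.2]

def encodeClause (C : List Literal) : List Bool :=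
  C.flatMap (fun l => true :: encodeLiteral l) ++ [false]

def encodeCNF (φ : CNF) : List Bool :=
  φ.flatMap (fun C => true :: encodeClause C) ++ [false]

/-- The language SAT. The size of an instance is its length as a string. -/
def SAT : Set (List Bool) := {x | ∃ φ : CNF, encodeCNF φ = x ∧ CNF.Satisfiable φ}

/-! ## Two-prover one-round interactive proofs -/

/-- The verifier of a two-prover one-round proof system.  On input `x` the randomness, the questions
to and the answers of prover `i` range over finite sets `R`, `Qᵢ`, `Aᵢ`, listed as `0, 1, …`. -/
structure Verifier where
  nR : List Bool → ℕ
  nQ₁ : List Bool → ℕ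
  nQ₂ : List Bool → ℕ
  nA₁ : List Bool → ℕ
  nA₂ : List Bool → ℕ
  nR_pos : ∀ x, 0 < nR x
  nA₁_pos : ∀ x, 0 < nA₁ x
  nA₂_pos : ∀ x, 0 < nA₂ x
  query₁ : ∀ x, Fin (nR x) → Fin (nQ₁ x)
  query₂ : ∀ x, Fin (nR x) → Fin (nQ₂ x)
  accept : ∀ x, Fin (nR x) → Fin (nA₁ x) → Fin (nA₂ x) → Bool

namespace Verifier

/-- The verifier is a polynomial-time algorithm: it computes the sizes of its sets, its questions, and
its verdict. -/
def Efficient (V : Verifier) : Prop :=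
  PolyTime (fun x => [x]) (fun x => unary (V.nR x)) ∧
  PolyTime (fun x => [x]) (fun x => unary (V.nQ₁ x)) ∧
  PolyTime (fun x => [x]) (fun x => unary (V.nQ₂ x)) ∧
  PolyTime (fun x => [x]) (fun x => unary (V.nA₁ x)) ∧
  PolyTime (fun x => [x]) (fun x => unary (V.nA₂ x)) ∧
  PolyTime (α := (x : List Bool) × Fin (V.nR x))
    (fun a => [a.1, unary a.2]) (fun a => unary (V.query₁ a.1 a.2)) ∧
  PolyTime (α := (x : List Bool) × Fin (V.nR x))
    (fun a => [a.1, unary a.2]) (fun a => unary (V.query₂ a.1 a.2)) ∧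
  PolyTime (α := (x : List Bool) × Fin (V.nR x) × Fin (V.nA₁ x) × Fin (V.nA₂ x))
    (fun a => [a.1, unary a.2.1, unary a.2.2.1, unary a.2.2.2])
    (fun a => [V.accept a.1 a.2.1 a.2.2.1 a.2.2.2])

/-- The probability that the verifier accepts `x` when the provers use the strategies `P₁`, `P₂`. -/
noncomputable def value (V : Verifier) (x : List Bool)
    (P₁ : Fin (V.nQ₁ x) → Fin (V.nA₁ x)) (P₂ : Fin (V.nQ₂ x) → Fin (V.nA₂ x)) : ℝ :=
  ((Finset.univ.filter fun r : Fin (V.nR x) =>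
    V.accept x r (P₁ (V.query₁ x r)) (P₂ (V.query₂ x r)) = true).card : ℝ) / V.nR x

def PerfectCompleteness (V : Verifier) (L : Set (List Bool)) : Prop :=
  ∀ x ∈ L, ∃ P₁ P₂, V.value x P₁ P₂ = 1

/-- The soundness error on inputs of size `N` is at most `ε N`. -/
def SoundnessError (V : Verifier) (L : Set (List Bool)) (ε : ℕ → ℝ) : Prop :=
  ∀ x ∉ L, ∀ P₁ P₂, V.value x P₁ P₂ ≤ ε x.length

/-- All five sets have size at most `b N` on inputs of size `N`. -/
def SizeBound (V : Verifier) (b : ℕ → ℝ) : Prop :=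
  ∀ x, (V.nR x : ℝ) ≤ b x.length ∧ (V.nQ₁ x : ℝ) ≤ b x.length ∧ (V.nQ₂ x : ℝ) ≤ b x.length ∧
    (V.nA₁ x : ℝ) ≤ b x.length ∧ (V.nA₂ x : ℝ) ≤ b x.length

def Functionality (V : Verifier) : Prop :=
  ∀ x r a₁ a₂ a₂', V.accept x r a₁ a₂ = true → V.accept x r a₁ a₂' = true → a₂ = a₂'

/-- The question to each prover is uniformly distributed over the question set. -/
def Uniformity (V : Verifier) : Prop :=
  ∀ x,
    (∀ q, ((Finset.univ.filter fun r => V.query₁ x r = q).card : ℝ) / V.nR x = 1 / V.nQ₁ x) ∧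
    (∀ q, ((Finset.univ.filter fun r => V.query₂ x r = q).card : ℝ) / V.nR x = 1 / V.nQ₂ x)

end Verifier

/-- The Biregular Projection Games Conjecture.  The bound `(N + 1/ε)^d + d` is the general form of a
bound `poly(N, 1/ε)`. -/
def BiregularPGC : Prop :=
  ∃ c : ℝ, 0 < c ∧ ∃ d : ℕ, ∀ ε : ℕ → ℝ, (∀ N : ℕ, 0 < ε N ∧ 1 / (N : ℝ) ^ c ≤ ε N) →
    ∃ V : Verifier, V.Efficient ∧ V.PerfectCompleteness SAT ∧ V.SoundnessError SAT ε ∧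
      V.SizeBound (fun N => ((N : ℝ) + 1 / ε N) ^ d + d) ∧ V.Functionality ∧ V.Uniformity

/-! ## Sparse regression -/

/-- The class `p^{Ω(1)}`. -/
def PolyGrowth (f : ℕ → ℝ) : Prop :=
  ∃ c : ℝ, 0 < c ∧ ∀ᶠ p : ℕ in Filter.atTop, (p : ℝ) ^ c ≤ f p

/-- A Boolean matrix as a real 0/1 matrix. -/
def toReal {m p : ℕ} (B : Matrix (Fin m) (Fin p) Bool) : Matrix (Fin m) (Fin p) ℝ :=
  B.map fun b => if b then 1 else 0

/-- Encoding of a Boolean matrix: dimensions in unary, then the entries row by row. -/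
def encodeMatrix {m p : ℕ} (B : Matrix (Fin m) (Fin p) Bool) : List Bool :=
  unary m ++ [false] ++ unary p ++ [false] ++
    (List.ofFn fun i => List.ofFn fun j => B i j).flatten

/-- `B x = e` has a 0/1 solution with at most `k` nonzero entries. -/
def HasExactSparse {m p : ℕ} (B : Matrix (Fin m) (Fin p) Bool) (k : ℕ) : Prop :=
  ∃ x : Fin p → ℝ, (∀ j, x j = 0 ∨ x j = 1) ∧ (toReal B).mulVec x = 1 ∧ hammingNorm x ≤ k

/-- Every real `x` with `‖B x - e‖² ≤ Δ` (Euclidean norm) has at least `K` nonzero entries. -/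
def OnlyDense {m p : ℕ} (B : Matrix (Fin m) (Fin p) Bool) (Δ K : ℝ) : Prop :=
  ∀ x : Fin p → ℝ, ‖WithLp.toLp 2 ((toReal B).mulVec x - 1)‖ ^ 2 ≤ Δ → K ≤ (hammingNorm x : ℝ)

/-- Encoded `m(p) × p` matrices, `p ≥ p₀`, with an exact `k(p)`-sparse 0/1 solution. -/
def sparseCase (m : Polynomial ℕ) (k : ℕ → ℕ) (p₀ : ℕ) : Set (List Bool) :=
  {y | ∃ (p : ℕ) (B : Matrix (Fin (m.eval p)) (Fin p) Bool),
    p₀ ≤ p ∧ y = encodeMatrix B ∧ HasExactSparse B (k p)}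

/-- Encoded `m(p) × p` matrices, `p ≥ p₀`, all of whose `Δ(p)`-approximate solutions have at least
`k(p) σ(p)` nonzero entries. -/
def denseCase (m : Polynomial ℕ) (k : ℕ → ℕ) (σ Δ : ℕ → ℝ) (p₀ : ℕ) : Set (List Bool) :=
  {y | ∃ (p : ℕ) (B : Matrix (Fin (m.eval p)) (Fin p) Bool),
    p₀ ≤ p ∧ y = encodeMatrix B ∧ OnlyDense B (Δ p) (k p * σ p)}

end SparseReg

/-!
Given a verifier with small soundness error, choose `H` polynomially larger than its question and
answer sets and give every question at least `⌊H / nQᵢ⌋` copies among `0, …, H - 1`.  The unknowns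
are weights of the answers to every copy, `p = H²` columns in all.  A row belongs to a random string
`r`, copies `u` and `v` of the questions asked under `r`, and an answer `b` of the second prover; it
says that the weights of the answers to `u` accepted together with `b` and of the answers to `v`
other than `b` add up to `1`.  By functionality, strategies that are always accepted give an exact
solution with one nonzero weight for each prover and copy, `2 H` in total.

The base-`H` digits of the row index encode `(r, u, v, b)` in the four lowest places, and the
remaining six digits only repeat the row, whence `m = H¹⁰ = p⁵`.  As each equation occurs `H⁶`
times, a total squared error of at most `Δ = p` leaves it an error of at most `1 / H²`, which is too
small to spread the weight over answers that are never accepted: for all copies of the questions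
asked under `r`, the supports of the weights contain an accepted pair of answers.  So an approximate
solution with `K H` nonzero entries gives, for the copy of each question with the shortest support,
lists of answers with average lengths adding up to at most `2 K`.  Answering at random from lists of
lengths `l₁` and `l₂` wins with probability at least the mean of `1 / (l₁ l₂) ≥ 4 / (l₁ + l₂)²`,
hence at least `1 / K²` by Jensen's inequality; uniformity turns the averages over questions into
averages over `r`.  For `K = 3 σ(p)` this contradicts soundness once `σ` is a small enough power
of `p`.

Since only large inputs have a small soundness error, the finitely many short ones are mapped to the
all-ones matrix, which has a solution with one nonzero entry, or to the zero matrix, which has no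
approximate solution at all.
-/

namespace SparseReg

/-! ## Execution of programs -/

namespace Exec

theorem deterministic {P : Prog} {s s₁ s₂ : Regs} {t₁ t₂ : ℕ} (h₁ : Exec P s t₁ s₁)
    (h₂ : Exec P s t₂ s₂) : t₁ = t₂ ∧ s₁ = s₂ := by
  induction h₁ generalizing t₂ s₂ <;> cases h₂
  case seq.seq ih₁ ih₂ _ _ _ e₁ e₂ =>
    obtain ⟨rfl, rfl⟩ := ih₁ e₁
    obtain ⟨rfl, rfl⟩ := ih₂ e₂
    exact ⟨rfl, rfl⟩
  case loop_step.loop_step ih₁ ih₂ _ _ _ _ e₁ e₂ =>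
    obtain ⟨rfl, rfl⟩ := ih₁ e₁
    obtain ⟨rfl, rfl⟩ := ih₂ e₂
    exact ⟨rfl, rfl⟩
  all_goals grind

theorem length_le {P : Prog} {s s' : Regs} {t : ℕ} (h : Exec P s t s') (i : ℕ) :
    (s' i).length ≤ (s i).length + t := by
  induction h with
  | push j b s | pop j s =>
    rcases eq_or_ne i j with rfl | hij
    · grind
    · simp [Function.update_of_ne hij]
  | _ => grind

end Exec

/-- A strict upper bound on the registers mentioned by a program. -/
def Prog.bound : Prog → ℕ
  | .skip => 0
  | .push i _ => i + 1
  | .pop i => i + 1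
  | .seq P Q => max P.bound Q.bound
  | .branch i P Q R => max (i + 1) (max P.bound (max Q.bound R.bound))
  | .loop i P => max (i + 1) P.bound

theorem Exec.eq_of_bound_le {P : Prog} {s s' : Regs} {t : ℕ} (h : Exec P s t s') {j : ℕ}
    (hj : P.bound ≤ j) : s' j = s j := by
  induction h with
  | push i b s | pop i s => exact Function.update_of_ne (by grind [Prog.bound]) _ _
  | _ => grind [Prog.bound]

/-- The program acting on the registers `b, b + 1, …` as `P` acts on `0, 1, …`. -/
def Prog.shift (b : ℕ) : Prog → Prog
  | .skip => .skip
  | .push i c => .push (i + b) c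
  | .pop i => .pop (i + b)
  | .seq P Q => .seq (P.shift b) (Q.shift b)
  | .branch i P Q R => .branch (i + b) (P.shift b) (Q.shift b) (R.shift b)
  | .loop i P => .loop (i + b) (P.shift b)

/-- The register contents `S 0, …, S (b - 1), s 0, s 1, …`. -/
def onTop (b : ℕ) (S s : Regs) : Regs := fun j => if j < b then S j else s (j - b)

@[simp]
theorem onTop_add (b : ℕ) (S s : Regs) (i : ℕ) : onTop b S s (i + b) = s i := by
  simp [onTop]

theorem onTop_update (b : ℕ) (S s : Regs) (i : ℕ) (v : List Bool) :
    onTop b S (Function.update s i v) = Function.update (onTop b S s) (i + b) v := by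
  funext j
  simp only [onTop, Function.update_apply]
  grind

theorem load_append (l l' : List (List Bool)) :
    load (l ++ l') = onTop l.length (load l) (load l') := by
  funext j
  simp only [load, onTop, List.getD_eq_getElem?_getD]
  grind

theorem load_append_nil (l : List (List Bool)) : load (l ++ [[]]) = load l := by
  funext j
  simp only [load, List.getD_eq_getElem?_getD]
  grind

theorem Exec.shift {P : Prog} {s s' : Regs} {t : ℕ} (h : Exec P s t s') (b : ℕ) (S : Regs) :
    Exec (P.shift b) (onTop b S s) t (onTop b S s') := by
  induction h with
  | skip s => exact .skip _
  | push i c s =>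
    simpa only [Prog.shift, onTop_update, onTop_add] using Exec.push (i + b) c (onTop b S s)
  | pop i s => simpa only [Prog.shift, onTop_update, onTop_add] using Exec.pop (i + b) (onTop b S s)
  | seq _ _ ih₁ ih₂ => exact .seq ih₁ ih₂
  | branch_empty h _ ih => exact .branch_empty (by rwa [onTop_add]) ih
  | branch_false h _ ih => exact .branch_false (by rwa [onTop_add]) ih
  | branch_true h _ ih => exact .branch_true (by rwa [onTop_add]) ih
  | loop_done h => exact .loop_done (by rwa [onTop_add])
  | loop_step h _ _ ih₁ ih₂ => exact .loop_step (by rwa [onTop_add]) ih₁ ih₂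

/-- Started from `s`, the program `P` halts within `T` steps, with register contents `s'`. -/
def Runs (P : Prog) (s s' : Regs) (T : ℕ) : Prop := ∃ t ≤ T, Exec P s t s'

namespace Runs

theorem mono {P : Prog} {s s' : Regs} {T T' : ℕ} (h : Runs P s s' T) (hT : T ≤ T') :
    Runs P s s' T' := by
  obtain ⟨t, ht, e⟩ := h
  exact ⟨t, ht.trans hT, e⟩

theorem congr {P : Prog} {s s' s'' : Regs} {T T' : ℕ} (h : Runs P s s' T)
    (hs : ∀ i, s'' i = s' i) (hT : T ≤ T') : Runs P s s'' T' :=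
  funext hs ▸ h.mono hT

theorem seq {P Q : Prog} {s s' s'' : Regs} {T T' : ℕ} (h : Runs P s s' T)
    (h' : Runs Q s' s'' T') : Runs (.seq P Q) s s'' (T + T') := by
  obtain ⟨t, ht, e⟩ := h
  obtain ⟨t', ht', e'⟩ := h'
  exact ⟨_, Nat.add_le_add ht ht', .seq e e'⟩

theorem shift {P : Prog} {l l' l'' : List (List Bool)} {T : ℕ}
    (h : Runs P (load l') (load l'') T) :
    Runs (P.shift l.length) (load (l ++ l')) (load (l ++ l'')) T := by
  obtain ⟨t, ht, e⟩ := h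
  rw [load_append, load_append]
  exact ⟨t, ht, e.shift _ _⟩

theorem loop {i : ℕ} {P : Prog} {T : ℕ} (N : ℕ) (S : ℕ → Regs) (hne : ∀ k < N, S k i ≠ [])
    (hstep : ∀ k < N, Runs P (S k) (S (k + 1)) T) (hend : S N i = []) :
    Runs (.loop i P) (S 0) (S N) (N * (T + 1) + 1) := by
  induction N generalizing S with
  | zero => exact ⟨1, by simp, .loop_done hend⟩
  | succ N ih =>
    obtain ⟨t, ht, e⟩ := hstep 0 N.succ_pos
    obtain ⟨t', ht', e'⟩ := ih (fun k => S (k + 1)) (fun k hk => hne _ (by lia))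
      (fun k hk => hstep _ (by lia)) hend
    exact ⟨t + t' + 1, by grind, .loop_step (hne 0 N.succ_pos) e e'⟩

end Runs

/-- Push the bit `c` on each of the registers `js`. -/
def pushAll (c : Bool) : List ℕ → Prog
  | [] => .skip
  | j :: js => .seq (.push j c) (pushAll c js)

theorem runs_pushAll (c : Bool) {js : List ℕ} (hjs : js.Nodup) (s : Regs) :
    Runs (pushAll c js) s (fun m => if m ∈ js then c :: s m else s m) (js.length + 1) := by
  induction js generalizing s with
  | nil => exact ⟨1, by simp, by simpa [pushAll] using Exec.skip s⟩
  | cons j js ih =>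
    obtain ⟨hj, hjs⟩ := List.nodup_cons.1 hjs
    obtain ⟨t, ht, e⟩ := ih hjs (Function.update s j (c :: s j))
    refine ⟨1 + t, by grind, .seq (.push j c s) ?_⟩
    convert e using 2 with m
    grind [Function.update_apply]

/-- Move the top bit of register `i`, if there is one, to each of the registers `js`. -/
def pourStep (i : ℕ) (js : List ℕ) : Prog :=
  .branch i .skip (.seq (.pop i) (pushAll false js)) (.seq (.pop i) (pushAll true js))

theorem runs_pourStep {i : ℕ} {js : List ℕ} (hjs : js.Nodup) (hi : i ∉ js) {s : Regs} {c : Bool}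
    {x : List Bool} (hs : s i = c :: x) :
    Runs (pourStep i js) s (fun m => if m = i then x else if m ∈ js then c :: s m else s m)
      (js.length + 3) := by
  obtain ⟨t, ht, e⟩ := runs_pushAll c hjs (Function.update s i (s i).tail)
  have hpush : Exec (pushAll c js) (Function.update s i (s i).tail) t
      (fun m => if m = i then x else if m ∈ js then c :: s m else s m) := by
    convert e using 2 with m
    grind [Function.update_apply]
  refine ⟨1 + t + 1, by lia, ?_⟩
  cases c with
  | false => exact .branch_false (by rw [hs]; rfl) (.seq (.pop i s) hpush)
  | true => exact .branch_true (by rw [hs]; rfl) (.seq (.pop i s) hpush)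

/-- Empty the register `i`, pushing its bits from the top one on each of the registers `js`. -/
def pour (i : ℕ) (js : List ℕ) : Prog := .loop i (pourStep i js)

theorem runs_pour {i : ℕ} {js : List ℕ} (hjs : js.Nodup) (hi : i ∉ js) (s : Regs) :
    Runs (pour i js) s
      (fun m => if m = i then [] else if m ∈ js then (s i).reverse ++ s m else s m)
      ((s i).length * (js.length + 4) + 1) := by
  let S : ℕ → Regs := fun k m =>
    if m = i then (s i).drop k else if m ∈ js then ((s i).take k).reverse ++ s m else s m
  have hS (k : ℕ) : S k i = (s i).drop k := if_pos rfl
  have hstep : ∀ k < (s i).length, Runs (pourStep i js) (S k) (S (k + 1)) (js.length + 3) := by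
    intro k hk
    refine (runs_pourStep hjs hi ((hS k).trans (List.drop_eq_getElem_cons hk))).congr
      (fun m => ?_) le_rfl
    simp only [S, ← List.take_append_getElem hk]
    grind
  have hstart : S 0 = s := by funext m; grind
  have hloop := Runs.loop (i := i) (s i).length S (by simp [hS]) hstep (by simp [hS])
  rw [hstart] at hloop
  exact hloop.congr (by simp [S]) le_rfl

/-- Put the contents of register `1` in front of those of register `0`. -/
def prepend : Prog := .seq (pour 1 [2]) (pour 2 [0])

theorem runs_prepend (x y : List Bool) :
    Runs prepend (load [x, y]) (load [y ++ x]) (10 * y.length + 2) := by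
  have h := (runs_pour (i := 1) (js := [2]) (by simp) (by simp) (load [x, y])).seq
    (runs_pour (i := 2) (js := [0]) (by simp) (by simp) _)
  refine h.congr (fun m => ?_) ?_
  · rcases m with _ | _ | _ | m <;> simp [load]
  · simp [load]
    lia

/-- Copy the contents of register `i` to the empty register `b`, by way of the empty register
`b + 1`. -/
def copy (i b : ℕ) : Prog := .seq (pour i [b + 1]) (pour (b + 1) [i, b])

theorem runs_copy (l : List (List Bool)) {i : ℕ} (hi : i < l.length) :
    Runs (copy i l.length) (load l) (load (l ++ [l[i]])) (11 * l[i].length + 2) := by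
  have h := (runs_pour (i := i) (js := [l.length + 1]) (by simp) (by grind) (load l)).seq
    (runs_pour (i := l.length + 1) (js := [i, l.length]) (by grind) (by grind) _)
  refine h.congr (fun m => ?_) ?_
  · simp only [load, List.getD_eq_getElem?_getD]
    grind
  · simp [load, hi]
    grind

theorem length_load_le_inputSize (l : List (List Bool)) (i : ℕ) :
    (load l i).length ≤ inputSize l := by
  by_cases hi : i < l.length
  · simpa [load, hi, inputSize] using
      List.single_le_sum (by simp) _ (List.mem_map_of_mem (List.getElem_mem hi))
  · simp [load, hi]

/-- Move the contents of register `n` to register `0`, by way of the empty register `n + 1`. -/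
def bringToFront (n : ℕ) : Prog := .seq (pour n [n + 1]) (.seq (pour 0 []) (pour (n + 1) [0]))

theorem runs_bringToFront (l : List (List Bool)) (x : List Bool) :
    ∃ s, Runs (bringToFront l.length) (load (l ++ [x])) s (14 * inputSize (l ++ [x]) + 3) ∧
      s 0 = x := by
  refine ⟨_, ((runs_pour (js := [l.length + 1]) (by simp) (by simp) _).seq
    ((runs_pour (js := []) (by simp) (by simp) _).seq
      (runs_pour (js := [0]) (by simp) (by simp) _))).mono ?_, ?_⟩
  · have h₀ := length_load_le_inputSize (l ++ [x]) 0
    have hx := length_load_le_inputSize (l ++ [x]) l.length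
    simp only [load, List.getD_eq_getElem?_getD] at h₀ hx ⊢
    grind
  · simp [load]

/-- Empty the registers `1, …, k`. -/
def clearUpTo : ℕ → Prog
  | 0 => .skip
  | k + 1 => .seq (clearUpTo k) (pour (k + 1) [])

theorem runs_clearUpTo (k : ℕ) {s : Regs} {L : ℕ} (hL : ∀ i, (s i).length ≤ L) :
    Runs (clearUpTo k) s (fun i => if 1 ≤ i ∧ i ≤ k then [] else s i) (k * (L * 4 + 1) + 1) := by
  induction k with
  | zero =>
    exact Runs.congr ⟨1, le_rfl, .skip s⟩ (by grind) (by simp)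
  | succ k ih =>
    refine (ih.seq (runs_pour (i := k + 1) (js := []) (by simp) (by simp) _)).congr ?_ ?_
    · grind
    · have := hL (k + 1)
      grind

theorem PolyTime.exists_runs_load {α : Type} {inp : α → List (List Bool)} {out : α → List Bool}
    (h : PolyTime inp out) {n : ℕ} (hn : ∀ a, (inp a).length ≤ n) :
    ∃ (P : Prog) (τ : Polynomial ℕ), ∀ a,
      Runs P (load (inp a)) (load [out a]) (τ.eval (inputSize (inp a))) := by
  obtain ⟨P, τ, hP⟩ := h
  let k := max n P.bound
  refine ⟨.seq P (clearUpTo k), τ + (k * ((.X + τ) * 4 + 1) + 1 : Polynomial ℕ), fun a => ?_⟩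
  obtain ⟨t, s, e, hs, ht⟩ := hP a
  have hlen : ∀ i, (s i).length ≤ inputSize (inp a) + τ.eval (inputSize (inp a)) := fun i =>
    (e.length_le i).trans (Nat.add_le_add (length_load_le_inputSize _ i) ht)
  have hclear := runs_clearUpTo k hlen
  have hfinal : (fun i => if 1 ≤ i ∧ i ≤ k then [] else s i) = load [out a] := by
    funext i
    rcases Nat.eq_zero_or_pos i with rfl | hi
    · simp [load, hs]
    · by_cases hik : i ≤ k
      · simp only [load, List.getD_eq_getElem?_getD]; grind
      · have := hn a
        rw [if_neg (by simp [hik]), e.eq_of_bound_le (by lia)]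
        simp only [load, List.getD_eq_getElem?_getD]
        grind
  rw [hfinal] at hclear
  exact (Runs.seq ⟨t, ht, e⟩ hclear).mono (by simp)

/-! ## Polynomial-time extension of the register contents -/

theorem monotone_eval {R : Type*} [Semiring R] [PartialOrder R] [CanonicallyOrderedAdd R]
    [IsOrderedRing R] (τ : Polynomial R) : Monotone fun x => τ.eval x := by
  intro x y hxy
  simp only [Polynomial.eval_eq_sum, Polynomial.sum]
  gcongr

theorem inputSize_append (l l' : List (List Bool)) :
    inputSize (l ++ l') = inputSize l + inputSize l' := by
  simp [inputSize]

theorem Runs.inputSize_le {P : Prog} {l l' : List (List Bool)} {T : ℕ}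
    (h : Runs P (load l) (load l') T) : inputSize l' ≤ l'.length * (inputSize l + T) := by
  obtain ⟨t, ht, e⟩ := h
  have hbound : ∀ n ∈ l'.map List.length, n ≤ inputSize l + T := by
    intro n hn
    obtain ⟨i, hi, rfl⟩ := List.getElem_of_mem hn
    have hi' : i < l'.length := by simpa using hi
    have h₁ := e.length_le i
    have h₂ := length_load_le_inputSize l i
    have h₃ : load l' i = l'[i] := by simp [load, hi']
    rw [List.getElem_map, ← h₃]
    lia
  simpa [inputSize] using List.sum_le_card_nsmul _ _ hbound

/-- A list of strings depending on an input of type `α`: the contents of the first registers at some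
point of a computation. -/
abbrev Context (α : Type) : Type := List (α → List Bool)

/-- The strings of the context `Γ` on the input `a`. -/
def Context.eval {α : Type} (Γ : Context α) (a : α) : List (List Bool) := Γ.map (· a)

namespace Context

variable {α : Type}

@[simp]
theorem length_eval (Γ : Context α) (a : α) : (Γ.eval a).length = Γ.length := List.length_map _

@[simp]
theorem eval_append (Γ Δ : Context α) (a : α) :
    Context.eval (Γ ++ Δ) a = Γ.eval a ++ Δ.eval a := List.map_append

@[simp]
theorem eval_singleton (f : α → List Bool) (a : α) : Context.eval [f] a = [f a] := rfl

end Context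

/-- The choice between three values according to the first bit of a string, if there is one. -/
def caseHead {γ : Type} (e b c : γ) : List Bool → γ
  | [] => e
  | false :: _ => b
  | true :: _ => c

/-- In time polynomial in the lengths of the strings of `Γ`, some program adds the strings of `Δ`
after those of `Γ`, leaving the latter unchanged and all further registers empty. -/
def PolyTimeFrom {α : Type} (Γ Δ : Context α) : Prop :=
  ∃ (P : Prog) (τ : Polynomial ℕ), ∀ a,
    Runs P (load (Γ.eval a)) (load ((Γ ++ Δ).eval a)) (τ.eval (inputSize (Γ.eval a)))

namespace PolyTimeFrom

variable {α β : Type} {Γ Γ' Δ Θ : Context α} {f g : α → List Bool}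

theorem nil (Γ : Context α) : PolyTimeFrom Γ [] :=
  ⟨.skip, 1, fun a => ⟨1, by simp, by simpa using Exec.skip _⟩⟩

theorem exists_inputSize_le (h : PolyTimeFrom Γ Δ) :
    ∃ τ : Polynomial ℕ, ∀ a, inputSize ((Γ ++ Δ).eval a) ≤ τ.eval (inputSize (Γ.eval a)) := by
  obtain ⟨P, τ, hP⟩ := h
  exact ⟨((Γ ++ Δ).length : Polynomial ℕ) * (.X + τ), fun a => (hP a).inputSize_le.trans
    (by simp [Context.eval])⟩

theorem exists_length_le (h : PolyTimeFrom Γ [f]) :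
    ∃ τ : Polynomial ℕ, ∀ a, (f a).length ≤ τ.eval (inputSize (Γ.eval a)) := by
  obtain ⟨τ, hτ⟩ := h.exists_inputSize_le
  refine ⟨τ, fun a => le_trans ?_ (hτ a)⟩
  simp [Context.eval, inputSize]

theorem trans (h : PolyTimeFrom Γ Δ) (h' : PolyTimeFrom (Γ ++ Δ) Θ) : PolyTimeFrom Γ (Δ ++ Θ) := by
  obtain ⟨σ, hσ⟩ := h.exists_inputSize_le
  obtain ⟨P, τ, hP⟩ := h
  obtain ⟨Q, υ, hQ⟩ := h'
  refine ⟨.seq P Q, τ + υ.comp σ, fun a => ?_⟩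
  rw [← List.append_assoc]
  refine ((hP a).seq (hQ a)).mono ?_
  rw [Polynomial.eval_add, Polynomial.eval_comp]
  exact Nat.add_le_add_left (monotone_eval υ (hσ a)) _

theorem of_mem (hf : f ∈ Γ) : PolyTimeFrom Γ [f] := by
  obtain ⟨i, hi, rfl⟩ := List.getElem_of_mem hf
  refine ⟨copy i Γ.length, 11 * .X + 2, fun a => ?_⟩
  have hi' : i < (Γ.eval a).length := by simpa
  have hget : (Γ.eval a)[i] = Γ[i] a := List.getElem_map _
  have hcopy := runs_copy (Γ.eval a) hi'
  have hlen := length_load_le_inputSize (Γ.eval a) i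
  rw [load, List.getD_eq_getElem _ _ hi'] at hlen
  rw [Context.length_eval, hget] at hcopy
  rw [Context.eval_append]
  refine hcopy.mono ?_
  simpa [← hget] using hlen

theorem of_forall_mem (h : ∀ f ∈ Δ, ∀ Θ, PolyTimeFrom (Γ ++ Θ) [f]) : PolyTimeFrom Γ Δ := by
  suffices ∀ Θ, PolyTimeFrom (Γ ++ Θ) Δ by simpa using this []
  induction Δ with
  | nil => exact fun Θ => nil _
  | cons f Δ ih =>
    intro Θ
    refine (h f (by simp) Θ).trans ?_
    rw [List.append_assoc]
    exact ih (fun g hg => h g (by simp [hg])) _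

theorem of_subset (h : Δ ⊆ Γ) : PolyTimeFrom Γ Δ :=
  of_forall_mem fun _ hf _ => of_mem (List.mem_append_left _ (h hf))

theorem polyTime (h : PolyTimeFrom Γ [f]) : PolyTime Γ.eval f := by
  obtain ⟨υ, hυ⟩ := h.exists_inputSize_le
  obtain ⟨P, τ, hP⟩ := h
  refine ⟨.seq P (bringToFront Γ.length), τ + (14 * υ + 3), fun a => ?_⟩
  obtain ⟨s, hs, hs0⟩ := runs_bringToFront (Γ.eval a) (f a)
  have hP' := hP a
  rw [Context.eval_append, Context.eval_singleton] at hP'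
  rw [Context.length_eval] at hs
  obtain ⟨t, ht, e⟩ := hP'.seq hs
  refine ⟨t, s, e, hs0, ht.trans ?_⟩
  simpa using hυ a

theorem comp_polyTime (hΔ : PolyTimeFrom Γ Δ) (hf : PolyTime Δ.eval f) :
    PolyTimeFrom Γ [f] := by
  obtain ⟨σ, hσ⟩ := hΔ.exists_inputSize_le
  obtain ⟨P, τ, hP⟩ := hΔ
  obtain ⟨Q, υ, hQ⟩ := hf.exists_runs_load (n := Δ.length) (by simp [Context.eval])
  refine ⟨.seq P (Q.shift Γ.length), τ + υ.comp σ, fun a => ?_⟩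
  have hQ' := (hQ a).shift (l := Γ.eval a)
  rw [Context.length_eval, ← Context.eval_append] at hQ'
  rw [Context.eval_append Γ [f]]
  refine ((hP a).seq hQ').mono ?_
  have hle : inputSize (Δ.eval a) ≤ σ.eval (inputSize (Γ.eval a)) :=
    le_trans (by simp [inputSize_append]) (hσ a)
  rw [Polynomial.eval_add, Polynomial.eval_comp]
  exact Nat.add_le_add_left (monotone_eval υ hle) _

theorem mono (h : PolyTimeFrom Γ [f]) (hΓ : Γ ⊆ Γ') : PolyTimeFrom Γ' [f] :=
  (of_subset hΓ).comp_polyTime h.polyTime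

theorem mem (h : PolyTimeFrom Γ Δ) (hf : f ∈ Δ) : PolyTimeFrom Γ [f] :=
  h.comp_polyTime (of_mem hf).polyTime

theorem comp {Δ : Context β} {g : β → List Bool} (hg : PolyTime Δ.eval g) (e : α → β)
    (h : ∀ f ∈ Δ, PolyTimeFrom Γ [f ∘ e]) : PolyTimeFrom Γ [g ∘ e] := by
  refine comp_polyTime (Δ := Δ.map (· ∘ e)) (of_forall_mem ?_) ?_
  · intro f hf Θ
    obtain ⟨f, hfΔ, rfl⟩ := List.mem_map.1 hf
    exact (h f hfΔ).mono (List.subset_append_left _ _)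
  · obtain ⟨P, τ, hP⟩ := hg
    refine ⟨P, τ, fun a => ?_⟩
    simpa [Context.eval, Function.comp_def] using hP (e a)

/-! ## Elementary operations on strings -/

theorem const_nil (Γ : Context α) : PolyTimeFrom Γ [fun _ => []] := by
  refine ⟨.skip, 1, fun a => ⟨1, by simp, ?_⟩⟩
  rw [Context.eval_append, Context.eval_singleton, load_append_nil]
  exact .skip _

theorem cons (b : Bool) (hf : PolyTimeFrom Γ [f]) : PolyTimeFrom Γ [fun a => b :: f a] :=
  hf.comp_polyTime ⟨.push 0 b, 1, fun _ => ⟨1, _, .push 0 b _, rfl, by simp⟩⟩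

theorem const (Γ : Context α) (x : List Bool) : PolyTimeFrom Γ [fun _ => x] := by
  induction x with
  | nil => exact const_nil Γ
  | cons b x ih => exact ih.cons b

theorem tail (hf : PolyTimeFrom Γ [f]) : PolyTimeFrom Γ [fun a => (f a).tail] :=
  hf.comp_polyTime ⟨.pop 0, 1, fun _ => ⟨1, _, .pop 0 _, rfl, by simp⟩⟩

theorem binary {F : List Bool → List Bool → List Bool}
    (hF : PolyTime (fun x : List Bool × List Bool => [x.1, x.2]) fun x => F x.1 x.2)
    (hf : PolyTimeFrom Γ [f]) (hg : PolyTimeFrom Γ [g]) :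
    PolyTimeFrom Γ [fun a => F (f a) (g a)] :=
  comp (Δ := [Prod.fst, Prod.snd]) hF (fun a => (f a, g a)) (by simpa using ⟨hf, hg⟩)

theorem append (hf : PolyTimeFrom Γ [f]) (hg : PolyTimeFrom Γ [g]) :
    PolyTimeFrom Γ [fun a => f a ++ g a] := by
  refine binary (F := fun y x => x ++ y) ⟨prepend, 10 * .X + 2, fun x => ?_⟩ hg hf
  obtain ⟨t, ht, e⟩ := runs_prepend x.1 x.2
  exact ⟨t, _, e, rfl, ht.trans (by simp [inputSize])⟩

theorem drop_length (hf : PolyTimeFrom Γ [f]) (hg : PolyTimeFrom Γ [g]) :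
    PolyTimeFrom Γ [fun a => (f a).drop (g a).length] := by
  refine binary (F := fun x y => x.drop y.length)
    ⟨.loop 1 (.seq (.pop 1) (.pop 0)), 3 * .X + 1, fun x => ?_⟩ hf hg
  let S : ℕ → Regs := fun k => load [x.1.drop k, x.2.drop k]
  obtain ⟨t, ht, e⟩ := Runs.loop (i := 1) (P := .seq (.pop 1) (.pop 0)) (T := 2) x.2.length S
    (by simp [S, load]) (fun k _ => Runs.congr ⟨2, le_rfl, .seq (.pop 1 _) (.pop 0 _)⟩
      (fun m => by rcases m with _ | _ | m <;> simp [S, load]) le_rfl) (by simp [S, load])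
  exact ⟨t, _, e, rfl, ht.trans (by simp [inputSize]; lia)⟩

theorem unary_length (hf : PolyTimeFrom Γ [f]) :
    PolyTimeFrom Γ [fun a => unary (f a).length] := by
  suffices PolyTimeFrom Γ [fun a => unary (f a).length ++ []] by simpa using this
  refine binary (F := fun y x => unary x.length ++ y)
    ⟨.loop 1 (.seq (.pop 1) (.push 0 true)), 3 * .X + 1, fun x => ?_⟩ (const_nil Γ) hf
  let S : ℕ → Regs := fun k => load [unary k ++ x.1, x.2.drop k]
  obtain ⟨t, ht, e⟩ := Runs.loop (i := 1) (P := .seq (.pop 1) (.push 0 true)) (T := 2) x.2.length S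
    (by simp [S, load]) (fun k _ => Runs.congr ⟨2, le_rfl, .seq (.pop 1 _) (.push 0 true _)⟩
      (fun m => by rcases m with _ | _ | m <;> simp [S, load, unary, List.replicate_succ]) le_rfl)
    (by simp [S, load])
  exact ⟨t, _, e, rfl, ht.trans (by simp [inputSize]; lia)⟩

theorem case_head (e b c : List Bool) (hf : PolyTimeFrom Γ [f]) :
    PolyTimeFrom Γ [fun a => caseHead e b c (f a)] := by
  suffices PolyTimeFrom [id] [caseHead e b c] from comp this.polyTime f (by simpa using hf)
  obtain ⟨P, ρ, hP⟩ := const [id] e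
  obtain ⟨Q, σ, hQ⟩ := const [id] b
  obtain ⟨R, τ, hR⟩ := const [id] c
  refine ⟨.branch 0 P Q R, ρ + σ + τ + 1, fun x => ?_⟩
  simp only [Polynomial.eval_add, Polynomial.eval_one]
  match x with
  | [] =>
    obtain ⟨t, ht, e⟩ := hP []
    exact ⟨t + 1, by lia, .branch_empty rfl e⟩
  | false :: x =>
    obtain ⟨t, ht, e⟩ := hQ (false :: x)
    exact ⟨t + 1, by lia, .branch_false rfl e⟩
  | true :: x =>
    obtain ⟨t, ht, e⟩ := hR (true :: x)
    exact ⟨t + 1, by lia, .branch_true rfl e⟩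

section Bool

variable {b c : α → Bool}

theorem not (hb : PolyTimeFrom Γ [fun a => [b a]]) : PolyTimeFrom Γ [fun a => [!b a]] := by
  convert hb.case_head [] [true] [false] using 3 with a
  cases b a <;> rfl

theorem toBits (hb : PolyTimeFrom Γ [fun a => [b a]]) :
    PolyTimeFrom Γ [fun a => if b a then [true] else []] := by
  convert hb.case_head [] [] [true] using 3 with a
  cases b a <;> rfl

theorem or (hb : PolyTimeFrom Γ [fun a => [b a]]) (hc : PolyTimeFrom Γ [fun a => [c a]]) :
    PolyTimeFrom Γ [fun a => [b a || c a]] := by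
  convert (hb.toBits.append hc.toBits).case_head [false] [] [true] using 3 with a
  cases b a <;> cases c a <;> rfl

theorem and (hb : PolyTimeFrom Γ [fun a => [b a]]) (hc : PolyTimeFrom Γ [fun a => [c a]]) :
    PolyTimeFrom Γ [fun a => [b a && c a]] := by
  simpa using (hb.not.or hc.not).not

theorem length_lt_and (F : List Bool → Bool) (N : ℕ) (hf : PolyTimeFrom Γ [f]) :
    PolyTimeFrom Γ [fun a => [decide ((f a).length < N) && F (f a)]] := by
  induction N generalizing f F with
  | zero => simpa using const Γ [false]
  | succ N ih =>
    have hhead (e b c : Bool) : PolyTimeFrom Γ [fun a => [caseHead e b c (f a)]] := by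
      convert hf.case_head [e] [b] [c] using 3 with a
      rcases f a with _ | ⟨_ | _, x⟩ <;> rfl
    have hfalse := (hhead false true false).and (ih (fun x => F (false :: x)) hf.tail)
    have htrue := (hhead false false true).and (ih (fun x => F (true :: x)) hf.tail)
    convert (hhead (F []) false false).or (hfalse.or htrue) using 3 with a
    rcases f a with _ | ⟨_ | _, x⟩ <;> simp [caseHead] <;> congr

end Bool

section Arithmetic

variable {m n : α → ℕ}

theorem unary_add (hm : PolyTimeFrom Γ [fun a => unary (m a)])
    (hn : PolyTimeFrom Γ [fun a => unary (n a)]) :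
    PolyTimeFrom Γ [fun a => unary (m a + n a)] := by
  simpa [unary, ← List.replicate_add] using hm.append hn

theorem unary_sub (hm : PolyTimeFrom Γ [fun a => unary (m a)])
    (hn : PolyTimeFrom Γ [fun a => unary (n a)]) :
    PolyTimeFrom Γ [fun a => unary (m a - n a)] := by
  simpa [unary] using hm.drop_length hn

theorem decide_le (hm : PolyTimeFrom Γ [fun a => unary (m a)])
    (hn : PolyTimeFrom Γ [fun a => unary (n a)]) :
    PolyTimeFrom Γ [fun a => [decide (m a ≤ n a)]] := by
  convert (hm.unary_sub hn).case_head [true] [false] [false] using 3 with a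
  rcases hk : m a - n a with _ | k
  · simp [caseHead, unary, Nat.sub_eq_zero_iff_le.1 hk]
  · simp [caseHead, unary, List.replicate_succ]
    lia

theorem decide_lt (hm : PolyTimeFrom Γ [fun a => unary (m a)])
    (hn : PolyTimeFrom Γ [fun a => unary (n a)]) :
    PolyTimeFrom Γ [fun a => [decide (m a < n a)]] := by
  simpa [← decide_not] using (hn.decide_le hm).not

theorem decide_eq (hm : PolyTimeFrom Γ [fun a => unary (m a)])
    (hn : PolyTimeFrom Γ [fun a => unary (n a)]) :
    PolyTimeFrom Γ [fun a => [decide (m a = n a)]] := by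
  simpa [← Bool.decide_and, ← le_antisymm_iff] using (hm.decide_le hn).and (hn.decide_le hm)

end Arithmetic

end PolyTimeFrom

/-! ## Iteration and arithmetic -/

/-- With the registers `0, …, n - 1` unchanged, decrease the counter in register `n`, let `Q` put a
string in register `n + 2`, and put this string in front of the contents of register `n + 1`; repeat
until the counter is zero. -/
def iterate (n : ℕ) (Q : Prog) : Prog :=
  .loop n (.seq (.pop n) (.seq Q (prepend.shift (n + 1))))

theorem length_flatMap_le {ι κ : Type*} {l : List ι} {g : ι → List κ} {C : ℕ}
    (h : ∀ i ∈ l, (g i).length ≤ C) : (l.flatMap g).length ≤ l.length * C := by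
  simpa [List.length_flatMap] using
    List.sum_le_card_nsmul (l.map fun i => (g i).length) C (by simpa using h)

theorem runs_iterate {Q : Prog} {l : List (List Bool)} {g : ℕ → List Bool} {N C T : ℕ}
    (hg : ∀ i < N, (g i).length ≤ C)
    (hQ : ∀ i < N, ∀ y : List Bool, y.length ≤ N * C →
      Runs Q (load (l ++ [unary i, y])) (load (l ++ [unary i, y, g i])) T) :
    Runs (iterate l.length Q) (load (l ++ [unary N, []]))
      (load (l ++ [[], (List.range N).flatMap g])) (N * (T + 10 * C + 4) + 1) := by
  let acc : ℕ → List Bool := fun j => ((List.range N).drop j).flatMap g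
  let S : ℕ → Regs := fun k => load (l ++ [unary (N - k), acc (N - k)])
  have hacc (j : ℕ) : (acc j).length ≤ N * C :=
    (length_flatMap_le fun i hi => hg i (List.mem_range.1 (List.mem_of_mem_drop hi))).trans
      (Nat.mul_le_mul_right _ (by simp))
  have hstep : ∀ k < N, Runs (.seq (.pop l.length) (.seq Q (prepend.shift (l.length + 1))))
      (S k) (S (k + 1)) (T + 10 * C + 3) := by
    intro k hk
    obtain ⟨i, hi⟩ : ∃ i, N - k = i + 1 := ⟨N - k - 1, by lia⟩
    have hi' : N - (k + 1) = i := by lia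
    have hpop : Runs (.pop l.length) (S k) (load (l ++ [unary i, acc (i + 1)])) 1 := by
      have h : Runs (.pop 0) (load [unary (i + 1), acc (i + 1)]) (load [unary i, acc (i + 1)]) 1 :=
        Runs.congr ⟨1, le_rfl, .pop 0 _⟩
          (fun m => by rcases m with _ | m <;> simp [load, unary, List.replicate_succ]) le_rfl
      simpa [Prog.shift, S, hi] using h.shift (l := l)
    have hprepend := (runs_prepend (acc (i + 1)) (g i)).shift (l := l ++ [unary i])
    have hcons : acc i = g i ++ acc (i + 1) := by
      simp only [acc]
      rw [List.drop_eq_getElem_cons (by simp; lia)]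
      simp
    have := hg i (by lia)
    simp only [S, hi', hcons]
    simp only [List.append_assoc, List.length_append] at hprepend
    exact (hpop.seq ((hQ i (by lia) _ (hacc _)).seq hprepend)).mono (by lia)
  have hcounter (k : ℕ) : S k l.length = unary (N - k) := by simp [S, load]
  have hloop := Runs.loop (i := l.length) N S
    (fun k hk => by simpa [hcounter, unary] using Nat.sub_ne_zero_of_lt hk) hstep
    (by simp [hcounter, unary])
  have hend : S N = load (l ++ [[], (List.range N).flatMap g]) := by simp [S, acc, unary]
  have hstart : S 0 = load (l ++ [unary N, []]) := by
    simp [S, acc, List.drop_eq_nil_of_le]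
  rwa [hstart, hend] at hloop

theorem count_eq_of_forall_iff {p : ℕ → Prop} [DecidablePred p] {k n : ℕ}
    (hp : ∀ i < n, p i ↔ i < k) (hk : k ≤ n) : Nat.count p n = k := by
  rw [Nat.count_eq_card_filter_range]
  have : (Finset.range n).filter p = Finset.range k := by
    ext i
    simp only [Finset.mem_filter, Finset.mem_range]
    grind
  simp [this]

/-- The strings of `Γ`, followed by an index in unary. -/
def Context.withIndex {α : Type} (Γ : Context α) : Context (α × ℕ) :=
  Γ.map (· ∘ Prod.fst) ++ [fun b => unary b.2]

namespace PolyTimeFrom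

variable {α : Type} {Γ : Context α} {f : α → List Bool}

theorem extend_withIndex {g : α × ℕ → List Bool} (hg : PolyTimeFrom Γ.withIndex [g]) :
    ∃ (Q : Prog) (τ : Polynomial ℕ), ∀ a i y,
      Runs Q (load (Γ.eval a ++ [unary i, y])) (load (Γ.eval a ++ [unary i, y, g (a, i)]))
        (τ.eval (inputSize (Γ.eval a) + i + y.length)) := by
  have h : PolyTimeFrom (Γ.withIndex.map (· ∘ Prod.fst) ++ [Prod.snd]) [g ∘ Prod.fst] :=
    comp hg.polyTime Prod.fst fun f hf => of_mem (by simpa using Or.inl ⟨f, hf, rfl⟩)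
  obtain ⟨Q, τ, hQ⟩ := h
  refine ⟨Q, τ, fun a i y => ?_⟩
  simpa [Context.eval, Context.withIndex, inputSize, Function.comp_def, unary, Nat.add_assoc]
    using hQ ((a, i), y)

theorem flatMap {N : α → ℕ} {g : α × ℕ → List Bool}
    (hN : PolyTimeFrom Γ [fun a => unary (N a)]) (hg : PolyTimeFrom Γ.withIndex [g]) :
    PolyTimeFrom Γ [fun a => (List.range (N a)).flatMap fun i => g (a, i)] := by
  obtain ⟨Q, τ, hQ⟩ := extend_withIndex hg
  obtain ⟨γ, hγ⟩ := hg.exists_length_le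
  obtain ⟨ν, hν⟩ := hN.exists_length_le
  obtain ⟨P, π, hP⟩ := hN
  let C : Polynomial ℕ := γ.comp (.X + ν)
  let T : Polynomial ℕ := τ.comp (.X + ν + ν * C)
  suffices PolyTimeFrom Γ [fun _ => [], fun a => (List.range (N a)).flatMap fun i => g (a, i)] from
    this.mem (by simp)
  refine ⟨.seq P (iterate Γ.length Q), π + (ν * (T + 10 * C + 4) + 1), fun a => ?_⟩
  let n := inputSize (Γ.eval a)
  have hNa : N a ≤ ν.eval n := by simpa [unary] using hν a
  have hga : ∀ i < N a, (g (a, i)).length ≤ C.eval n := by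
    intro i hi
    refine (hγ (a, i)).trans ?_
    rw [Polynomial.eval_comp]
    refine monotone_eval γ ?_
    simpa [Context.withIndex, inputSize, Context.eval, unary, n, Function.comp_def]
      using (hi.trans_le hNa).le
  have hiterate := runs_iterate (Q := Q) (l := Γ.eval a) (T := T.eval n) hga fun i hi y hy =>
    (hQ a i y).mono (by
      simp only [T, Polynomial.eval_comp, Polynomial.eval_add, Polynomial.eval_X,
        Polynomial.eval_mul]
      exact monotone_eval τ (by gcongr; exacts [hi.le.trans hNa, hy.trans (by gcongr)]))
  have hP' := hP a
  rw [Context.eval_append, Context.eval_singleton, ← load_append_nil (_ ++ _),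
    List.append_assoc] at hP'
  rw [Context.eval_append]
  rw [Context.length_eval] at hiterate
  refine (hP'.seq hiterate).mono ?_
  simp only [Polynomial.eval_add, Polynomial.eval_mul, Polynomial.eval_ofNat, Polynomial.eval_one]
  gcongr

theorem weaken (hf : PolyTimeFrom Γ [f]) : PolyTimeFrom Γ.withIndex [fun b => f b.1] :=
  comp hf.polyTime Prod.fst fun _ h =>
    of_mem (List.mem_append_left _ (List.mem_map_of_mem h))

theorem index : PolyTimeFrom Γ.withIndex [fun b => unary b.2] :=
  of_mem (List.mem_append_right _ (List.mem_singleton_self _))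

section Arithmetic

variable {m n : α → ℕ}

theorem unary_mul (hm : PolyTimeFrom Γ [fun a => unary (m a)])
    (hn : PolyTimeFrom Γ [fun a => unary (n a)]) :
    PolyTimeFrom Γ [fun a => unary (m a * n a)] := by
  convert hm.flatMap hn.weaken using 3 with a
  rw [eq_comm, unary, List.eq_replicate_iff]
  simp [List.length_flatMap, unary]

theorem unary_const (k : ℕ) : PolyTimeFrom Γ [fun _ => unary k] := const Γ _

theorem unary_pow (hm : PolyTimeFrom Γ [fun a => unary (m a)]) (k : ℕ) :
    PolyTimeFrom Γ [fun a => unary (m a ^ k)] := by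
  induction k with
  | zero => simpa using unary_const 1
  | succ k ih => simpa [pow_succ] using ih.unary_mul hm

theorem unary_eval (hm : PolyTimeFrom Γ [fun a => unary (m a)]) (p : Polynomial ℕ) :
    PolyTimeFrom Γ [fun a => unary (p.eval (m a))] := by
  induction p using Polynomial.induction_on' with
  | add p q hp hq => simpa using hp.unary_add hq
  | monomial k c => simpa using (unary_const c).unary_mul (hm.unary_pow k)

theorem unary_count {N : α → ℕ} {p : α → ℕ → Prop} [∀ a, DecidablePred (p a)]
    (hN : PolyTimeFrom Γ [fun a => unary (N a)])
    (hp : PolyTimeFrom Γ.withIndex [fun b => [decide (p b.1 b.2)]]) :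
    PolyTimeFrom Γ [fun a => unary (Nat.count (p a) (N a))] := by
  convert hN.flatMap hp.toBits using 3 with a
  induction N a with
  | zero => simp [unary]
  | succ N ih =>
    rw [List.range_succ, List.flatMap_append, ← ih, Nat.count_succ]
    by_cases h : p a N <;> simp [unary, List.replicate_succ', h]

theorem unary_div (hm : PolyTimeFrom Γ [fun a => unary (m a)])
    (hn : PolyTimeFrom Γ [fun a => unary (n a)]) :
    PolyTimeFrom Γ [fun a => unary (m a / n a)] := by
  have hquot : PolyTimeFrom Γ.withIndex
      [fun b => [decide (0 < n b.1 ∧ (b.2 + 1) * n b.1 ≤ m b.1)]] := by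
    simpa using ((unary_const 0).decide_lt hn.weaken).and
      (((index.unary_add (unary_const 1)).unary_mul hn.weaken).decide_le hm.weaken)
  convert hm.unary_count (p := fun a i => 0 < n a ∧ (i + 1) * n a ≤ m a) hquot using 4 with a
  refine (count_eq_of_forall_iff (fun i _ => ?_) (Nat.div_le_self _ _)).symm
  rcases Nat.eq_zero_or_pos (n a) with h | h
  · simp [h]
  · rw [and_iff_right h, ← Nat.le_div_iff_mul_le h, Nat.succ_le_iff]

theorem unary_mod (hm : PolyTimeFrom Γ [fun a => unary (m a)])
    (hn : PolyTimeFrom Γ [fun a => unary (n a)]) :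
    PolyTimeFrom Γ [fun a => unary (m a % n a)] := by
  simpa [← Nat.mod_eq_sub_div_mul] using hm.unary_sub ((hm.unary_div hn).unary_mul hn)

theorem unary_sqrt (hm : PolyTimeFrom Γ [fun a => unary (m a)]) :
    PolyTimeFrom Γ [fun a => unary (Nat.sqrt (m a))] := by
  have hsucc : PolyTimeFrom Γ.withIndex [fun b => unary (b.2 + 1)] :=
    index.unary_add (unary_const 1)
  convert hm.unary_count (p := fun a i => (i + 1) * (i + 1) ≤ m a)
    ((hsucc.unary_mul hsucc).decide_le hm.weaken) using 4 with a
  refine (count_eq_of_forall_iff (fun i _ => ?_) (Nat.sqrt_le_self _)).symm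
  rw [← Nat.le_sqrt, Nat.succ_le_iff]

end Arithmetic

end PolyTimeFrom

/-! ## Reductions between promise problems -/

theorem Exec.accepts_iff {P : Prog} {x w : List Bool} {t : ℕ} {s : Regs}
    (h : Exec P (load [x, w]) t s) : Accepts P x w ↔ s 0 = [true] := by
  refine ⟨fun ⟨_, _, h', hs⟩ => ?_, fun hs => ⟨t, s, h, hs⟩⟩
  rwa [(h.deterministic h').2]

theorem acceptProb_congr {P P' : Prog} {x x' : List Bool} {n n' : ℕ} (hn : n = n')
    (h : ∀ w : Fin n → Bool, Accepts P x (List.ofFn w) ↔ Accepts P' x' (List.ofFn w)) :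
    acceptProb P n x = acceptProb P' n' x' := by
  subst hn
  unfold acceptProb
  congr 3
  ext w
  simp only [Finset.mem_filter, Finset.mem_univ, true_and, h]

theorem BPPDistinguishable.of_reduction {yes no yes' no' : Set (List Bool)}
    (h : BPPDistinguishable yes no) {e : List Bool → List Bool} (he : PolyTime (fun x => [x]) e)
    {ℓ : Polynomial ℕ} (hℓ : ∀ x, (e x).length = ℓ.eval x.length)
    (hyes : Set.MapsTo e yes' yes) (hno : Set.MapsTo e no' no) :
    BPPDistinguishable yes' no' := by
  obtain ⟨P, ρ, τ, hP, hPyes, hPno⟩ := h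
  have hρ (x : List Bool) : (ρ.comp ℓ).eval x.length = ρ.eval (e x).length := by
    rw [Polynomial.eval_comp, hℓ]
  let Input := {a : List Bool × List Bool //
    a.1 ∈ yes' ∪ no' ∧ a.2.length = (ρ.comp ℓ).eval a.1.length}
  have hhalts (a : Input) : ∃ (t : ℕ) (s : Regs),
      Exec P (load [e a.1.1, a.1.2]) t s ∧ t ≤ τ.eval (e a.1.1).length := by
    obtain ⟨⟨x, w⟩, hx, hw⟩ := a
    obtain ⟨w, rfl⟩ : ∃ w' : Fin (ρ.eval (e x).length) → Bool, List.ofFn w' = w := by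
      rw [← hρ, ← hw]
      exact ⟨w.get, List.ofFn_get w⟩
    exact hP (e x) (hx.imp (hyes ·) (hno ·)) w
  choose t s hexec htime using hhalts
  have hout : PolyTimeFrom [fun a : Input => a.1.1, fun a => a.1.2] [fun a => s a 0] := by
    refine .comp_polyTime (α := Input) (Δ := [fun a => e a.1.1, fun a => a.1.2])
      (.of_forall_mem fun f hf Θ => ?_) ⟨P, τ, fun a => ⟨t a, s a, hexec a, rfl, ?_⟩⟩
    · obtain rfl | rfl := List.mem_pair.1 hf
      · exact .comp (Δ := [id]) he (fun a : Input => a.1.1)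
          (by simpa using .of_mem (by simp))
      · exact .of_mem (by simp)
    · exact (htime a).trans (monotone_eval τ (by simp [Context.eval, inputSize]))
  obtain ⟨P', τ', hP'⟩ := hout.polyTime
  have haccepts (x) (hx : x ∈ yes' ∪ no') :
      acceptProb P' ((ρ.comp ℓ).eval x.length) x = acceptProb P (ρ.eval (e x).length) (e x) := by
    refine acceptProb_congr (hρ x) fun w => ?_
    obtain ⟨_, _, hexec', hs, -⟩ := hP' ⟨(x, List.ofFn w), hx, by simp⟩
    rw [hexec'.accepts_iff, hs, ← (hexec _).accepts_iff]
  refine ⟨P', ρ.comp ℓ, τ'.comp (.X + ρ.comp ℓ), fun x hx w => ?_,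
    fun x hx => haccepts x (.inl hx) ▸ hPyes _ (hyes hx),
    fun x hx => haccepts x (.inr hx) ▸ hPno _ (hno hx)⟩
  obtain ⟨t, s, hexec', -, ht⟩ := hP' ⟨(x, List.ofFn w), hx, by simp⟩
  exact ⟨t, s, hexec', ht.trans_eq (by simp [Context.eval, inputSize])⟩

/-! ## Strategies from short lists of answers -/

theorem exists_sum_div_card_le_sum_ite {R Q A : Type*} [Fintype R] [Finite Q]
    [DecidableEq A] [Nonempty A] (W : R → ℝ) {q : R → Q} {a : R → A} {Λ : Q → Finset A}
    (ha : ∀ r, a r ∈ Λ (q r)) :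
    ∃ P : Q → A, ∑ r, W r / (Λ (q r)).card ≤ ∑ r, if a r = P (q r) then W r else 0 := by
  classical
  have := Fintype.ofFinite Q
  have hpopular (y : Q) : ∃ b : A, ∑ r with q r = y, W r / (Λ (q r)).card ≤
      ∑ r with q r = y, if a r = b then W r else 0 := by
    rcases (Λ y).eq_empty_or_nonempty with hy | hy
    · have hfiber : ({r | q r = y} : Finset R) = ∅ := by
        simp only [Finset.filter_eq_empty_iff, Finset.mem_univ, forall_const]
        rintro r rfl
        simpa [hy] using ha r
      simp [hfiber]
    · have hcard : ((Λ y).card : ℝ) ≠ 0 := by simpa using hy.ne_empty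
      have hsum : ∑ _b ∈ Λ y, ∑ r with q r = y, W r / (Λ (q r)).card ≤
          ∑ b ∈ Λ y, ∑ r with q r = y, if a r = b then W r else 0 := by
        rw [Finset.sum_const, Finset.sum_comm, Finset.smul_sum]
        refine Finset.sum_le_sum fun r hr => ?_
        obtain rfl : q r = y := (Finset.mem_filter.1 hr).2
        rw [Finset.sum_ite_eq, if_pos (ha r), nsmul_eq_mul, mul_div_cancel₀ _ hcard]
      obtain ⟨b, -, hb⟩ := Finset.exists_le_of_sum_le hy hsum
      exact ⟨b, hb⟩
  choose P hP using hpopular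
  refine ⟨P, ?_⟩
  rw [← Finset.sum_fiberwise Finset.univ q, ← Finset.sum_fiberwise Finset.univ q]
  refine Finset.sum_le_sum fun y _ => (hP y).trans_eq (Finset.sum_congr rfl fun r hr => ?_)
  rw [(Finset.mem_filter.1 hr).2]

theorem sum_comp_div_card_eq {R Q : Type*} [Fintype R] [Nonempty R] [Fintype Q] [DecidableEq Q]
    {q : R → Q}
    (hq : ∀ y, ((Finset.univ.filter fun r => q r = y).card : ℝ) / Fintype.card R =
      1 / Fintype.card Q) (f : Q → ℝ) :
    (∑ r, f (q r)) / Fintype.card R = (∑ y, f y) / Fintype.card Q := by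
  rw [← Finset.sum_fiberwise' Finset.univ q f, Finset.sum_div, Finset.sum_div]
  refine Finset.sum_congr rfl fun y _ => ?_
  rw [Finset.sum_const, nsmul_eq_mul, mul_div_right_comm, hq, one_div_mul_eq_div]

theorem four_div_sq_le_sum_div_card {ι : Type*} [Fintype ι] [Nonempty ι] {s t : ι → ℝ}
    (hs : ∀ i, 0 < s i) (ht : ∀ i, 0 < t i) {a : ℝ}
    (h : (∑ i, (s i + t i)) / Fintype.card ι ≤ a) :
    4 / a ^ 2 ≤ (∑ i, 1 / (s i * t i)) / Fintype.card ι := by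
  have hmean : 0 < (∑ i, (s i + t i)) / Fintype.card ι :=
    div_pos (Finset.sum_pos (fun i _ => add_pos (hs i) (ht i)) Finset.univ_nonempty) (by positivity)
  have hamgm (i : ι) : 4 * (s i + t i) ^ (-2 : ℤ) ≤ 1 / (s i * t i) := by
    have := hs i
    have := ht i
    rw [zpow_neg, zpow_ofNat, ← div_eq_mul_inv, div_le_div_iff₀ (by positivity) (by positivity)]
    linarith [four_mul_le_sq_add (s i) (t i)]
  have hjensen := Real.zpow_arith_mean_le_arith_mean_zpow Finset.univ
    (fun _ => 1 / (Fintype.card ι : ℝ)) (fun i => s i + t i) (by simp)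
    (by simp) (fun i _ => add_pos (hs i) (ht i)) (-2)
  simp only [one_div_mul_eq_div, ← Finset.sum_div] at hjensen
  calc
    4 / a ^ 2 ≤ 4 / ((∑ i, (s i + t i)) / Fintype.card ι) ^ 2 := by gcongr
    _ = 4 * ((∑ i, (s i + t i)) / Fintype.card ι) ^ (-2 : ℤ) := by
      rw [zpow_neg, zpow_ofNat, div_eq_mul_inv]
    _ ≤ 4 * ((∑ i, (s i + t i) ^ (-2 : ℤ)) / Fintype.card ι) := by gcongr
    _ ≤ (∑ i, 1 / (s i * t i)) / Fintype.card ι := by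
      rw [← mul_div_assoc, Finset.mul_sum]
      gcongr with i
      exact hamgm i

namespace Verifier

variable {V : Verifier} {x : List Bool}

instance : NeZero (V.nR x) := ⟨(V.nR_pos x).ne'⟩

instance : NeZero (V.nA₁ x) := ⟨(V.nA₁_pos x).ne'⟩

instance : NeZero (V.nA₂ x) := ⟨(V.nA₂_pos x).ne'⟩

instance : NeZero (V.nQ₁ x) := ⟨(Fin.pos (V.query₁ x 0)).ne'⟩

instance : NeZero (V.nQ₂ x) := ⟨(Fin.pos (V.query₂ x 0)).ne'⟩

theorem Uniformity.exists_value_ge (hV : V.Uniformity)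
    {Λ₁ : Fin (V.nQ₁ x) → Finset (Fin (V.nA₁ x))} {Λ₂ : Fin (V.nQ₂ x) → Finset (Fin (V.nA₂ x))}
    (hΛ : ∀ r, ∃ a₁ ∈ Λ₁ (V.query₁ x r), ∃ a₂ ∈ Λ₂ (V.query₂ x r), V.accept x r a₁ a₂ = true)
    {a : ℝ} (ha : (∑ q, ((Λ₁ q).card : ℝ)) / V.nQ₁ x + (∑ q, ((Λ₂ q).card : ℝ)) / V.nQ₂ x ≤ a) :
    ∃ P₁ P₂, 4 / a ^ 2 ≤ V.value x P₁ P₂ := by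
  choose a₁ ha₁ a₂ ha₂ hacc using hΛ
  obtain ⟨P₁, hP₁⟩ := exists_sum_div_card_le_sum_ite
    (fun r => 1 / ((Λ₂ (V.query₂ x r)).card : ℝ)) ha₁
  obtain ⟨P₂, hP₂⟩ := exists_sum_div_card_le_sum_ite
    (fun r => if a₁ r = P₁ (V.query₁ x r) then (1 : ℝ) else 0) ha₂
  have hmean := four_div_sq_le_sum_div_card (a := a)
    (s := fun r => ((Λ₂ (V.query₂ x r)).card : ℝ)) (t := fun r => ((Λ₁ (V.query₁ x r)).card : ℝ))
    (fun r => by exact_mod_cast Finset.card_pos.2 ⟨_, ha₂ r⟩)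
    (fun r => by exact_mod_cast Finset.card_pos.2 ⟨_, ha₁ r⟩) (by
      rw [Finset.sum_add_distrib, add_div]
      rw [sum_comp_div_card_eq (q := V.query₁ x) (by simpa using (hV x).1)
        fun q => ((Λ₁ q).card : ℝ)]
      rw [sum_comp_div_card_eq (q := V.query₂ x) (by simpa using (hV x).2)
        fun q => ((Λ₂ q).card : ℝ)]
      simpa [add_comm] using ha)
  refine ⟨P₁, P₂, hmean.trans ?_⟩
  rw [value, Fintype.card_fin, Finset.card_filter, Nat.cast_sum]
  refine div_le_div_of_nonneg_right ?_ (Nat.cast_nonneg _)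
  calc
    _ ≤ ∑ r, if a₁ r = P₁ (V.query₁ x r) then 1 / ((Λ₂ (V.query₂ x r)).card : ℝ) else 0 := by
      simpa only [div_div] using hP₁
    _ ≤ _ := by simpa only [ite_div, zero_div] using hP₂
    _ ≤ _ := by
      refine Finset.sum_le_sum fun r _ => ?_
      have := hacc r
      split_ifs <;> simp_all

end Verifier

theorem exists_section_card_mul_sum_le {U Q : Type*} [Fintype U] [Fintype Q] [DecidableEq Q]
    {f : U → Q} {k : ℕ} (hk : 0 < k) (hf : ∀ q, k ≤ (Finset.univ.filter fun u => f u = q).card)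
    (L : U → ℕ) : ∃ g : Q → U, (∀ q, f (g q) = q) ∧ k * ∑ q, L (g q) ≤ ∑ u, L u := by
  have hmin (q : Q) := Finset.exists_min_image _ L (Finset.card_pos.1 (hk.trans_le (hf q)))
  choose g hg hle using hmin
  refine ⟨g, fun q => (Finset.mem_filter.1 (hg q)).2, ?_⟩
  rw [← Finset.sum_fiberwise Finset.univ f, Finset.mul_sum]
  refine Finset.sum_le_sum fun q _ => ?_
  calc
    k * L (g q) ≤ (Finset.univ.filter fun u => f u = q).card • L (g q) := by
      rw [smul_eq_mul]; gcongr; exact hf q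
    _ ≤ ∑ u with f u = q, L u := Finset.card_nsmul_le_sum _ _ _ (hle q)

theorem div_le_card_filter_ofNat_eq {n : ℕ} [NeZero n] (H : ℕ) (q : Fin n) :
    H / n ≤ (Finset.univ.filter fun u : Fin H => Fin.ofNat n u = q).card := by
  have hlt (t : Fin (H / n)) : n * t + q < H :=
    calc
      n * t + q < n * (t + 1) := by have := q.2; lia
      _ ≤ n * (H / n) := by gcongr; exact t.2
      _ ≤ H := Nat.mul_div_le H n
  calc
    H / n = (Finset.univ : Finset (Fin (H / n))).card := by simp
    _ ≤ _ := Finset.card_le_card_of_injOn (fun t => (⟨n * t + q, hlt t⟩ : Fin H)) (fun t _ => ?_)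
      (fun t _ t' _ h => ?_)
  · simp [Fin.ext_iff, Nat.mod_eq_of_lt q.2]
  · simpa [NeZero.ne n, Fin.ext_iff] using h

theorem le_two_mul_mul_div {n H : ℕ} (hn : 0 < n) (hH : n ≤ H) : H ≤ 2 * n * (H / n) := by
  have hpos : 0 < H / n := Nat.div_pos hH hn
  have hlt : H < n * (H / n + 1) := Nat.lt_mul_div_succ H hn
  nlinarith

theorem exists_section_ofNat_sum_div_le {n H : ℕ} [NeZero n] (hn : n ≤ H) (L : Fin H → ℕ) :
    ∃ g : Fin n → Fin H, (∀ q, Fin.ofNat n (g q) = q) ∧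
      (∑ q, (L (g q) : ℝ)) / n ≤ 2 * (∑ u, (L u : ℝ)) / H := by
  have hn0 : 0 < n := Nat.pos_of_neZero n
  obtain ⟨g, hg, hle⟩ := exists_section_card_mul_sum_le (Nat.div_pos hn hn0)
    (div_le_card_filter_ofNat_eq H) L
  refine ⟨g, hg, ?_⟩
  rw [div_le_div_iff₀ (mod_cast hn0) (mod_cast hn0.trans_le hn)]
  norm_cast
  calc
    (∑ q, L (g q)) * H ≤ (∑ q, L (g q)) * (2 * n * (H / n)) := by
      gcongr; exact le_two_mul_mul_div hn0 hn
    _ = 2 * (H / n * ∑ q, L (g q)) * n := by ring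
    _ ≤ 2 * (∑ u, L u) * n := by gcongr

/-! ## Linear constraints expressing acceptance -/

section

variable {A₁ A₂ : Type*} [Fintype A₁] [Fintype A₂] [DecidableEq A₂]

/-- The left-hand side of one constraint `… = 1` on weights `y₁` and `y₂` of the two provers'
answers.  For `0/1` weights selecting one answer each, the constraint `none` says that the second
prover selects something, and the constraint `some b` says that the first prover's answer is
accepted together with `b` exactly when the second prover selects `b`. -/
def rowSum (acc : A₁ → A₂ → Bool) (y₁ : A₁ → ℝ) (y₂ : A₂ → ℝ) : Option A₂ → ℝ
  | none => ∑ a, y₂ a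
  | some b => (∑ a with acc a b = true, y₁ a) + ∑ a with a ≠ b, y₂ a

theorem rowSum_single [DecidableEq A₁] {acc : A₁ → A₂ → Bool} {a₁ : A₁} {a₂ : A₂} {b : Option A₂}
    (hacc : ∀ b' ∈ b, (acc a₁ b' = true ↔ b' = a₂)) :
    rowSum acc (Pi.single a₁ 1) (Pi.single a₂ 1) b = 1 := by
  cases b with
  | none => simp [rowSum]
  | some b =>
    replace hacc := hacc b rfl
    by_cases hb : b = a₂
    · have htrue : acc a₁ b = true := hacc.2 hb
      subst hb
      simp [rowSum, htrue]
    · simp [rowSum, hacc, hb, Ne.symm]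

theorem exists_ne_zero_of_abs_rowSum_sub_one_le {acc : A₁ → A₂ → Bool} {y₁ : A₁ → ℝ} {y₂ : A₂ → ℝ}
    {δ : ℝ} (hδ : δ * (2 * Fintype.card A₂ + 1) < 1)
    (h : ∀ b, |rowSum acc y₁ y₂ b - 1| ≤ δ) :
    ∃ a₁ a₂, y₁ a₁ ≠ 0 ∧ y₂ a₂ ≠ 0 ∧ acc a₁ a₂ = true := by
  by_contra! hcon
  -- The constraints `none` and `some b` contradict each other unless `y₂ b ≤ 2 * δ`.
  have htotal : |∑ a, y₂ a - 1| ≤ δ := h none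
  have hle (b : A₂) : y₂ b ≤ 2 * δ := by
    by_cases hb : y₂ b = 0
    · linarith [(abs_nonneg _).trans htotal]
    have hzero : ∑ a with acc a b = true, y₁ a = 0 := Finset.sum_eq_zero fun a ha => by
      by_contra ha₁
      exact hcon a b ha₁ hb (Finset.mem_filter.1 ha).2
    have hrow := h (some b)
    rw [rowSum, hzero, zero_add, Finset.filter_ne', Finset.sum_erase_eq_sub (Finset.mem_univ b)]
      at hrow
    linarith [(abs_le.1 hrow).1, (abs_le.1 htotal).2]
  have hsum := Finset.sum_le_card_nsmul Finset.univ y₂ _ fun b _ => hle b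
  rw [nsmul_eq_mul, Finset.card_univ] at hsum
  linarith [(abs_le.1 htotal).1]

end

theorem card_mul_sq_le_norm_sq {ι κ : Type*} [Fintype ι] [Fintype κ] {e : κ → ι}
    (he : Function.Injective e) {z : ι → ℝ} {E : ℝ} (hz : ∀ t, z (e t) = E) :
    Fintype.card κ * E ^ 2 ≤ ‖WithLp.toLp 2 z‖ ^ 2 := by
  rw [EuclideanSpace.norm_sq_eq]
  calc
    Fintype.card κ * E ^ 2 = ∑ t, ‖z (e t)‖ ^ 2 := by simp [hz]
    _ = ∑ i ∈ Finset.univ.map ⟨e, he⟩, ‖z i‖ ^ 2 := by simp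
    _ ≤ ∑ i, ‖z i‖ ^ 2 :=
      Finset.sum_le_sum_of_subset_of_nonneg (Finset.subset_univ _) fun _ _ _ => by positivity

theorem hammingNorm_comp_le {ι κ M : Type*} [Fintype ι] [Fintype κ] [Zero M] [DecidableEq M]
    (e : κ ↪ ι) (y : ι → M) : hammingNorm (y ∘ e) ≤ hammingNorm y :=
  Finset.card_le_card_of_injOn e (fun _ => by simp) e.injective.injOn

theorem hammingNorm_extend_zero {ι κ M : Type*} [Fintype ι] [Fintype κ] [Zero M] [DecidableEq M]
    (e : κ ↪ ι) (z : κ → M) :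
    hammingNorm (Function.extend e z 0) = hammingNorm z := by
  classical
  rw [hammingNorm, hammingNorm, ← Finset.card_map e]
  congr 1 with j
  by_cases hj : ∃ c, e c = j
  · obtain ⟨c, rfl⟩ := hj
    simp [e.injective.extend_apply]
  · rw [not_exists] at hj
    simp [hj]

theorem hammingNorm_eq_sum_add {ι α β M : Type*} [Fintype ι] [Fintype α] [Fintype β] [Zero M]
    [DecidableEq M] (z : ι × (α ⊕ β) → M) :
    hammingNorm z =
      ∑ u, (hammingNorm (fun a => z (u, .inl a)) + hammingNorm fun b => z (u, .inr b)) := by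
  simp only [hammingNorm, Finset.card_filter, Fintype.sum_prod_type, Fintype.sum_sum_type]

theorem hammingNorm_single {ι M : Type*} [Fintype ι] [DecidableEq ι] [Zero M] [DecidableEq M]
    (i : ι) {c : M} (hc : c ≠ 0) : hammingNorm (Pi.single i c : ι → M) = 1 := by
  rw [hammingNorm, Finset.card_eq_one]
  exact ⟨i, by ext; simp [Pi.single_apply, hc]⟩

/-! ## The matrix of a verifier -/

/-- The digit of `i` at the place `H ^ k` in base `H`. -/
def digit (H : ℕ) [NeZero H] (k i : ℕ) : Fin H := Fin.ofNat H (i / H ^ k)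

theorem exists_injective_digit_eq {H : ℕ} [NeZero H] {k m n : ℕ} (hm : H ^ (k + n) = m)
    (d : Fin k → Fin H) : ∃ e : (Fin n → Fin H) → Fin m,
      Function.Injective e ∧ ∀ t, ∀ l : Fin k, digit H l (e t) = d l := by
  subst hm
  refine ⟨fun t => finFunctionFinEquiv (Fin.append d t), ?_, fun t l => Fin.ext ?_⟩
  · exact finFunctionFinEquiv.injective.comp
      ((Fin.appendEquiv k n).injective.comp (Prod.mk_right_injective d))
  · rw [digit, Fin.val_ofNat, ← Fin.val_castAdd n l, ← finFunctionFinEquiv_symm_apply_val,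
      Equiv.symm_apply_apply, Fin.append_left]

namespace Verifier

variable {V : Verifier} {x : List Bool}

theorem accept_of_value_eq_one {P₁ : Fin (V.nQ₁ x) → Fin (V.nA₁ x)}
    {P₂ : Fin (V.nQ₂ x) → Fin (V.nA₂ x)} (hV : V.value x P₁ P₂ = 1) (r : Fin (V.nR x)) :
    V.accept x r (P₁ (V.query₁ x r)) (P₂ (V.query₂ x r)) = true := by
  have hR : (V.nR x : ℝ) ≠ 0 := by simp [NeZero.ne]
  rw [value, div_eq_one_iff_eq hR, Nat.cast_inj] at hV
  have huniv := (Finset.card_eq_iff_eq_univ _).1 (hV.trans (Fintype.card_fin _).symm)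
  exact Finset.filter_eq_self.1 huniv r (Finset.mem_univ r)

theorem Functionality.accept_iff (hV : V.Functionality) {r : Fin (V.nR x)} {a₁ : Fin (V.nA₁ x)}
    {a₂ b : Fin (V.nA₂ x)} (h : V.accept x r a₁ a₂ = true) :
    V.accept x r a₁ b = true ↔ b = a₂ :=
  ⟨fun hb => hV x r a₁ b a₂ hb h, fun hb => hb ▸ h⟩

variable (V x) (H : ℕ)

/-- The sets of the verifier on input `x` are small enough for the matrix of order `H`, in which
every question has copies among `0, …, H - 1`, each with `H` columns to accommodate the answers. -/
structure FitsIn : Prop where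
  nR_le : V.nR x ≤ H
  nQ₁_le : V.nQ₁ x ≤ H
  nQ₂_le : V.nQ₂ x ≤ H
  nA_le : V.nA₁ x + V.nA₂ x ≤ H

variable [NeZero H]

/-- The random string belonging to row `i`. -/
def rowRand (i : ℕ) : Fin (V.nR x) := Fin.ofNat _ (digit H 0 i)

/-- Row `i` is a test if its digits at the places `H` and `H ^ 2` are copies of the questions asked
under its random string, where `u` is a copy of its remainder modulo the number of questions, and
its digit at the place `H ^ 3` is an answer of the second prover. -/
def IsTest (i : ℕ) : Bool :=
  decide (V.query₁ x (V.rowRand x H i) = (digit H 1 i : ℕ) % V.nQ₁ x) &&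
    (decide (V.query₂ x (V.rowRand x H i) = (digit H 2 i : ℕ) % V.nQ₂ x) &&
      decide ((digit H 3 i : ℕ) < V.nA₂ x))

/-- The entry of the matrix of the reduction in row `i` and column `s + H * w`.  This column belongs
to answer `s` of the first prover to the copy `w` if `s < nA₁`, and to answer `s - nA₁` of the
second prover if `nA₁ ≤ s < nA₁ + nA₂`. -/
def entry (i j : ℕ) : Bool :=
  (decide (j / H = digit H 1 i) && decide (j % H < V.nA₁ x) && V.IsTest x H i &&
      V.accept x (V.rowRand x H i) (Fin.ofNat _ (j % H)) (Fin.ofNat _ (digit H 3 i))) ||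
    (decide (j / H = digit H 2 i) && decide (V.nA₁ x ≤ j % H) &&
      decide (j % H < V.nA₁ x + V.nA₂ x) &&
      !(V.IsTest x H i && decide (j % H = V.nA₁ x + digit H 3 i)))

/-- The Boolean matrix of the reduction. -/
def matrix (m : ℕ) : Matrix (Fin m) (Fin (H * H)) Bool := fun i j => V.entry x H i j

/-- The answer tested by row `i`, if any. -/
def rowLabel (i : ℕ) : Option (Fin (V.nA₂ x)) :=
  if V.IsTest x H i then some (Fin.ofNat _ (digit H 3 i)) else none

variable {V x H}

/-- The columns belonging to an answer; all others vanish. -/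
def column (hF : V.FitsIn x H) : Fin H × (Fin (V.nA₁ x) ⊕ Fin (V.nA₂ x)) ↪ Fin (H * H) :=
  ((Function.Embedding.refl _).prodMap
    (finSumFinEquiv.toEmbedding.trans (Fin.castLEEmb hF.nA_le))).trans finProdFinEquiv.toEmbedding

theorem entry_column_inl (hF : V.FitsIn x H) (i : ℕ) (w : Fin H) (a : Fin (V.nA₁ x)) :
    V.entry x H i (column hF (w, .inl a)) = true ↔
      w = digit H 1 i ∧
        ∃ b ∈ V.rowLabel x H i, V.accept x (V.rowRand x H i) a b = true := by
  have hval : (column hF (w, .inl a) : ℕ) = a + H * w := rfl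
  have haH : (a : ℕ) < H := by have := a.2; have := hF.nA_le; lia
  have hdiv : (a + H * w : ℕ) / H = w := by
    rw [Nat.add_mul_div_left _ _ (Nat.pos_of_neZero H), Nat.div_eq_of_lt haH, zero_add]
  have hmod : (a + H * w : ℕ) % H = a := by rw [Nat.add_mul_mod_self_left, Nat.mod_eq_of_lt haH]
  by_cases ht : V.IsTest x H i <;>
    simp [entry, rowLabel, hval, hdiv, hmod, ht, Fin.val_inj, a.2.not_ge]

theorem entry_column_inr (hF : V.FitsIn x H) (i : ℕ) (w : Fin H) (a : Fin (V.nA₂ x)) :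
    V.entry x H i (column hF (w, .inr a)) = true ↔
      w = digit H 2 i ∧ a ∉ V.rowLabel x H i := by
  have hval : (column hF (w, .inr a) : ℕ) = (V.nA₁ x + a) + H * w := rfl
  have haH : (V.nA₁ x + a : ℕ) < H := by have := a.2; have := hF.nA_le; lia
  have hdiv : (V.nA₁ x + a + H * w : ℕ) / H = w := by
    rw [Nat.add_mul_div_left _ _ (Nat.pos_of_neZero H), Nat.div_eq_of_lt haH, zero_add]
  have hmod : (V.nA₁ x + a + H * w : ℕ) % H = V.nA₁ x + a := by
    rw [Nat.add_mul_mod_self_left, Nat.mod_eq_of_lt haH]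
  by_cases ht : V.IsTest x H i
  · have hb : (digit H 3 i : ℕ) % V.nA₂ x = digit H 3 i :=
      Nat.mod_eq_of_lt (by simp_all [IsTest])
    simp [entry, rowLabel, hval, hdiv, hmod, ht, Fin.ext_iff, hb, eq_comm (a := (a : ℕ))]
  · simp [entry, rowLabel, hval, hdiv, hmod, ht, Fin.ext_iff]

theorem exists_column_eq_of_entry (hF : V.FitsIn x H) {i : ℕ} {j : Fin (H * H)}
    (h : V.entry x H i j = true) : ∃ c, column hF c = j := by
  have hlt : (j : ℕ) % H < V.nA₁ x + V.nA₂ x := by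
    simp only [entry, Bool.or_eq_true, Bool.and_eq_true, decide_eq_true_eq] at h
    rcases h with h | h <;> lia
  refine ⟨(j.divNat, finSumFinEquiv.symm ⟨j % H, hlt⟩), Fin.ext ?_⟩
  simp [column, Nat.mod_add_div]

theorem toReal_matrix_mulVec (hF : V.FitsIn x H) {m : ℕ} (y : Fin (H * H) → ℝ) (i : Fin m) :
    (toReal (V.matrix x H m)).mulVec y i =
      rowSum (V.accept x (V.rowRand x H i)) (fun a => y (column hF (digit H 1 i, .inl a)))
        (fun a => y (column hF (digit H 2 i, .inr a))) (V.rowLabel x H i) := by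
  calc
    _ = ∑ j : Fin (H * H), if V.entry x H i j then y j else 0 := by
      rw [Matrix.mulVec, dotProduct]
      refine Finset.sum_congr rfl fun j _ => ?_
      by_cases h : V.entry x H i j <;> simp [toReal, matrix, h]
    _ = ∑ c, if V.entry x H i (column hF c) then y (column hF c) else 0 := by
      refine (Fintype.sum_of_injective _ (column hF).injective _ _ (fun j hj => ?_)
        fun _ => rfl).symm
      exact if_neg fun h => hj (exists_column_eq_of_entry hF h)
    _ = _ := by
      simp only [Fintype.sum_prod_type, Fintype.sum_sum_type, Finset.sum_add_distrib,
        entry_column_inl, entry_column_inr, ite_and, Finset.sum_ite_irrel, Finset.sum_const_zero,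
        Finset.sum_ite_eq', Finset.mem_univ, if_true]
      cases V.rowLabel x H i with
      | none => simp [rowSum]
      | some b => simp [rowSum, Finset.sum_filter, eq_comm (a := b)]

theorem queries_eq_of_mem_rowLabel {i : ℕ} {b : Fin (V.nA₂ x)} (hb : b ∈ V.rowLabel x H i) :
    Fin.ofNat _ (digit H 1 i) = V.query₁ x (V.rowRand x H i) ∧
      Fin.ofNat _ (digit H 2 i) = V.query₂ x (V.rowRand x H i) := by
  have ht : V.IsTest x H i = true := by
    by_contra ht
    simp [rowLabel, ht] at hb
  simp only [IsTest, Bool.and_eq_true, decide_eq_true_eq] at ht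
  exact ⟨Fin.ext ht.1.symm, Fin.ext ht.2.1.symm⟩

theorem exists_digits (hF : V.FitsIn x H) {r : Fin (V.nR x)} {u v : Fin H}
    (hu : Fin.ofNat _ u = V.query₁ x r) (hv : Fin.ofNat _ v = V.query₂ x r)
    (b : Option (Fin (V.nA₂ x))) :
    ∃ d : Fin 4 → Fin H, ∀ i : ℕ, (∀ l : Fin 4, digit H l i = d l) →
      V.rowRand x H i = r ∧ digit H 1 i = u ∧ digit H 2 i = v ∧ V.rowLabel x H i = b := by
  have hA : V.nA₂ x < H := by have := V.nA₁_pos x; have := hF.nA_le; lia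
  refine ⟨![Fin.castLE hF.nR_le r, u, v, b.elim ⟨V.nA₂ x, hA⟩ (Fin.castLE hA.le)],
    fun i hi => ?_⟩
  have h₀ : digit H 0 i = _ := hi 0
  have h₁ : digit H 1 i = _ := hi 1
  have h₂ : digit H 2 i = _ := hi 2
  have h₃ : digit H 3 i = _ := hi 3
  have hr : V.rowRand x H i = r := by simp [rowRand, h₀]
  refine ⟨hr, h₁, h₂, ?_⟩
  cases b <;> simp_all [rowLabel, IsTest, ← hu, ← hv]

theorem hasExactSparse_matrix (hF : V.FitsIn x H) (hf : V.Functionality) {m : ℕ}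
    {P₁ : Fin (V.nQ₁ x) → Fin (V.nA₁ x)} {P₂ : Fin (V.nQ₂ x) → Fin (V.nA₂ x)}
    (hV : V.value x P₁ P₂ = 1) : HasExactSparse (V.matrix x H m) (2 * H) := by
  let z : Fin H × (Fin (V.nA₁ x) ⊕ Fin (V.nA₂ x)) → ℝ := fun c =>
    Sum.elim (Pi.single (P₁ (Fin.ofNat _ c.1)) 1) (Pi.single (P₂ (Fin.ofNat _ c.1)) 1) c.2
  have hz (c) : z c = 0 ∨ z c = 1 := by
    rcases c with ⟨u, a | a⟩ <;> simp [z, Pi.single_apply, em']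
  refine ⟨Function.extend (column hF) z 0, fun j => ?_, ?_, ?_⟩
  · by_cases hj : ∃ c, column hF c = j
    · obtain ⟨c, rfl⟩ := hj
      simpa [(column hF).injective.extend_apply] using hz c
    · simp [Function.extend_apply' _ _ _ hj]
  · ext i
    simp only [toReal_matrix_mulVec hF, (column hF).injective.extend_apply]
    refine rowSum_single (a₁ := P₁ (Fin.ofNat _ (digit H 1 i)))
      (a₂ := P₂ (Fin.ofNat _ (digit H 2 i))) fun b hb => ?_
    obtain ⟨h₁, h₂⟩ := queries_eq_of_mem_rowLabel hb
    rw [h₁, h₂]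
    exact hf.accept_iff (accept_of_value_eq_one hV _)
  · rw [hammingNorm_extend_zero, hammingNorm_eq_sum_add]
    simp [z, hammingNorm_single, mul_comm]

theorem abs_rowSum_sub_one_le (hF : V.FitsIn x H) {m : ℕ} (hm : H ^ 10 = m)
    {y : Fin (H * H) → ℝ}
    (hy : ‖WithLp.toLp 2 ((toReal (V.matrix x H m)).mulVec y - 1)‖ ^ 2 ≤ (H * H : ℕ))
    {r : Fin (V.nR x)} {u v : Fin H} (hu : Fin.ofNat _ u = V.query₁ x r)
    (hv : Fin.ofNat _ v = V.query₂ x r) (b : Option (Fin (V.nA₂ x))) :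
    |rowSum (V.accept x r) (fun a => y (column hF (u, .inl a)))
      (fun a => y (column hF (v, .inr a))) b - 1| ≤ 1 / (H * H : ℕ) := by
  obtain ⟨d, hd⟩ := exists_digits hF hu hv b
  obtain ⟨e, he, hed⟩ := exists_injective_digit_eq (k := 4) (n := 6) hm d
  have hH : (0 : ℝ) < H := mod_cast Nat.pos_of_neZero H
  set E := rowSum (V.accept x r) (fun a => y (column hF (u, .inl a)))
    (fun a => y (column hF (v, .inr a))) b - 1
  have hrow (t) : ((toReal (V.matrix x H m)).mulVec y - 1) (e t) = E := by
    obtain ⟨hr, h₁, h₂, hb⟩ := hd (e t) (hed t)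
    simp only [Pi.sub_apply, Pi.one_apply, toReal_matrix_mulVec hF, hr, h₁, h₂, hb, E]
  have hsum : (H : ℝ) ^ 6 * E ^ 2 ≤ H * H := by
    simpa using (card_mul_sq_le_norm_sq he hrow).trans hy
  refine abs_le_of_sq_le_sq ?_ (by positivity)
  rw [Nat.cast_mul, div_pow, one_pow, le_div_iff₀ (by positivity)]
  refine le_of_mul_le_mul_left ?_ (by positivity : (0 : ℝ) < H * H)
  linarith

theorem exists_value_ge_of_norm_sq_le (hF : V.FitsIn x H) (hV : V.Uniformity) {m : ℕ}
    (hm : H ^ 10 = m) {y : Fin (H * H) → ℝ}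
    (hy : ‖WithLp.toLp 2 ((toReal (V.matrix x H m)).mulVec y - 1)‖ ^ 2 ≤ (H * H : ℕ))
    {K : ℝ} (hK : hammingNorm y ≤ K * H) : ∃ P₁ P₂, 1 / K ^ 2 ≤ V.value x P₁ P₂ := by
  have hH : (0 : ℝ) < H := mod_cast Nat.pos_of_neZero H
  let L₁ (u : Fin H) := hammingNorm fun a => y (column hF (u, .inl a))
  let L₂ (u : Fin H) := hammingNorm fun a => y (column hF (u, .inr a))
  have hL : (∑ u, (L₁ u : ℝ)) + ∑ u, (L₂ u : ℝ) ≤ K * H := by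
    refine le_trans ?_ hK
    rw [← Finset.sum_add_distrib]
    exact_mod_cast (hammingNorm_eq_sum_add _).symm.trans_le (hammingNorm_comp_le (column hF) y)
  obtain ⟨g₁, hg₁, hL₁⟩ := exists_section_ofNat_sum_div_le hF.nQ₁_le L₁
  obtain ⟨g₂, hg₂, hL₂⟩ := exists_section_ofNat_sum_div_le hF.nQ₂_le L₂
  have hδ : 1 / ((H * H : ℕ) : ℝ) * (2 * Fintype.card (Fin (V.nA₂ x)) + 1) < 1 := by
    have hA : 2 * V.nA₂ x + 1 < H * H := by
      have := V.nA₁_pos x; have := V.nA₂_pos x; have := hF.nA_le; nlinarith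
    rw [one_div_mul_eq_div, div_lt_one (mod_cast Nat.pos_of_neZero _), Fintype.card_fin]
    exact_mod_cast hA
  have hlist (r) := exists_ne_zero_of_abs_rowSum_sub_one_le hδ
    (abs_rowSum_sub_one_le hF hm hy (hg₁ (V.query₁ x r)) (hg₂ (V.query₂ x r)))
  have hvalue := hV.exists_value_ge
    (Λ₁ := fun q => Finset.univ.filter fun a => y (column hF (g₁ q, .inl a)) ≠ 0)
    (Λ₂ := fun q => Finset.univ.filter fun a => y (column hF (g₂ q, .inr a)) ≠ 0)
    (a := 2 * K) (fun r => by simpa [and_assoc] using hlist r) ?_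
  · convert hvalue using 5
    ring
  · calc
      _ ≤ 2 * (∑ u, (L₁ u : ℝ)) / H + 2 * (∑ u, (L₂ u : ℝ)) / H := add_le_add hL₁ hL₂
      _ = 2 * ((∑ u, (L₁ u : ℝ)) + ∑ u, (L₂ u : ℝ)) / H := by ring
      _ ≤ 2 * (K * H) / H := by gcongr
      _ = 2 * K := by field_simp

end Verifier

/-! ## Computing the matrix -/

theorem flatten_ofFn {m : ℕ} (g : ℕ → List Bool) :
    (List.ofFn fun i : Fin m => g i).flatten = (List.range m).flatMap g := by
  rw [List.flatMap_def]
  congr 1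
  exact List.ext_getElem (by simp) fun i _ _ => by simp

theorem length_encodeMatrix {m p : ℕ} (B : Matrix (Fin m) (Fin p) Bool) :
    (encodeMatrix B).length = m + 1 + p + 1 + m * p := by
  simp [encodeMatrix, unary, List.length_flatten, List.map_ofFn, Function.comp_def]
  ring

section

variable {α : Type} {Γ : Context α} {X : α → List Bool} {H i j m p : α → ℕ}

theorem PolyTimeFrom.encodeMatrix_of_entry {B : α → ℕ → ℕ → Bool}
    (hm : PolyTimeFrom Γ [fun a => unary (m a)]) (hp : PolyTimeFrom Γ [fun a => unary (p a)])
    (hB : PolyTimeFrom Γ.withIndex.withIndex [fun b => [B b.1.1 b.1.2 b.2]]) :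
    PolyTimeFrom Γ [fun a => encodeMatrix fun (i : Fin (m a)) (j : Fin (p a)) => B a i j] := by
  have hrow : PolyTimeFrom Γ.withIndex
      [fun b => (List.range (p b.1)).flatMap fun j => [B b.1 b.2 j]] := hp.weaken.flatMap hB
  have hsep := PolyTimeFrom.const Γ [false]
  convert (((hm.append hsep).append hp).append hsep).append (hm.flatMap hrow) using 3 with a
  unfold encodeMatrix
  rw [← flatten_ofFn]
  congr 3 with i : 1
  rw [← List.map_eq_flatMap]
  exact List.ext_getElem (by simp) (by simp)

theorem PolyTimeFrom.unary_digit [∀ a, NeZero (H a)] (hH : PolyTimeFrom Γ [fun a => unary (H a)])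
    (k : ℕ) (hi : PolyTimeFrom Γ [fun a => unary (i a)]) :
    PolyTimeFrom Γ [fun a => unary (digit (H a) k (i a))] :=
  (hi.unary_div (hH.unary_pow k)).unary_mod hH

namespace Verifier

variable {V : Verifier}

theorem Efficient.entry [∀ a, NeZero (H a)] (hV : V.Efficient) (hX : PolyTimeFrom Γ [X])
    (hH : PolyTimeFrom Γ [fun a => unary (H a)]) (hi : PolyTimeFrom Γ [fun a => unary (i a)])
    (hj : PolyTimeFrom Γ [fun a => unary (j a)]) :
    PolyTimeFrom Γ [fun a => [V.entry (X a) (H a) (i a) (j a)]] := by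
  obtain ⟨hR, hQ₁, hQ₂, hA₁, hA₂, hq₁, hq₂, hacc⟩ := hV
  have size {n : List Bool → ℕ} (hn : PolyTime (fun x => [x]) fun x => unary (n x)) :
      PolyTimeFrom Γ [fun a => unary (n (X a))] := .comp (Δ := [id]) hn X (by simpa using hX)
  let r (a : α) := V.rowRand (X a) (H a) (i a)
  let a₁ (a : α) : Fin (V.nA₁ (X a)) := Fin.ofNat _ (j a % H a)
  let a₂ (a : α) : Fin (V.nA₂ (X a)) := Fin.ofNat _ (digit (H a) 3 (i a))
  have hr : PolyTimeFrom Γ [fun a => unary (r a)] := (hH.unary_digit 0 hi).unary_mod (size hR)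
  have hs := hj.unary_mod hH
  have hw := hj.unary_div hH
  have ha₁ : PolyTimeFrom Γ [fun a => unary (a₁ a)] := hs.unary_mod (size hA₁)
  have hb := hH.unary_digit 3 hi
  have ha₂ : PolyTimeFrom Γ [fun a => unary (a₂ a)] := hb.unary_mod (size hA₂)
  have hq₁ : PolyTimeFrom Γ [fun a => unary (V.query₁ (X a) (r a))] :=
    .comp (Δ := [_, _]) hq₁ (fun a => ⟨X a, r a⟩) (by simpa using ⟨hX, hr⟩)
  have hq₂ : PolyTimeFrom Γ [fun a => unary (V.query₂ (X a) (r a))] :=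
    .comp (Δ := [_, _]) hq₂ (fun a => ⟨X a, r a⟩) (by simpa using ⟨hX, hr⟩)
  have hacc : PolyTimeFrom Γ [fun a => [V.accept (X a) (r a) (a₁ a) (a₂ a)]] :=
    .comp (Δ := [_, _, _, _]) hacc (fun a => ⟨X a, r a, a₁ a, a₂ a⟩)
      (by simpa using ⟨hX, hr, ha₁, ha₂⟩)
  have hu := hH.unary_digit 1 hi
  have hv := hH.unary_digit 2 hi
  have htest : PolyTimeFrom Γ [fun a => [V.IsTest (X a) (H a) (i a)]] :=
    (hq₁.decide_eq (hu.unary_mod (size hQ₁))).and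
      ((hq₂.decide_eq (hv.unary_mod (size hQ₂))).and (hb.decide_lt (size hA₂)))
  exact ((((hw.decide_eq hu).and (hs.decide_lt (size hA₁))).and htest).and hacc).or
    ((((hw.decide_eq hv).and ((size hA₁).decide_le hs)).and
      (hs.decide_lt ((size hA₁).unary_add (size hA₂)))).and
      (htest.and (hs.decide_eq ((size hA₁).unary_add hb))).not)

end Verifier

end

/-! ## The reduction -/

theorem HasExactSparse.mono {m p k k' : ℕ} {B : Matrix (Fin m) (Fin p) Bool}
    (h : HasExactSparse B k) (hk : k ≤ k') : HasExactSparse B k' :=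
  let ⟨x, hx, hBx, hxk⟩ := h
  ⟨x, hx, hBx, hxk.trans hk⟩

theorem hasExactSparse_true {m p : ℕ} (hp : 0 < p) :
    HasExactSparse (fun (_ : Fin m) (_ : Fin p) => true) 1 := by
  refine ⟨Pi.single ⟨0, hp⟩ 1, fun j => ?_, ?_, (hammingNorm_single _ one_ne_zero).le⟩
  · simp [Pi.single_apply, em']
  · ext i
    rw [Matrix.mulVec_single_one]
    rfl

theorem OnlyDense.mono {m p : ℕ} {B : Matrix (Fin m) (Fin p) Bool} {Δ K K' : ℝ}
    (h : OnlyDense B Δ K) (hK : K' ≤ K) : OnlyDense B Δ K' :=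
  fun x hx => hK.trans (h x hx)

theorem onlyDense_false {m p : ℕ} {Δ : ℝ} (hΔ : Δ < m) (K : ℝ) :
    OnlyDense (fun (_ : Fin m) (_ : Fin p) => false) Δ K := by
  intro y hy
  have hzero : toReal (fun (_ : Fin m) (_ : Fin p) => false) = 0 := rfl
  rw [hzero, Matrix.zero_mulVec, EuclideanSpace.norm_sq_eq] at hy
  norm_num at hy
  exact absurd hy hΔ.not_ge

namespace Verifier

variable {V : Verifier} {L : Set (List Bool)} {x : List Bool} {N₀ H m : ℕ}

theorem FitsIn.two_le (hF : V.FitsIn x H) : 2 ≤ H :=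
  (Nat.add_le_add (V.nA₁_pos x) (V.nA₂_pos x)).trans hF.nA_le

open Classical in
/-- The matrix to which the reduction from the language `L` maps `x`.  Inputs shorter than `N₀`, for
which the soundness error may be too large, are decided by a finite table: they are mapped to a
constant matrix. -/
noncomputable def reduction (V : Verifier) (L : Set (List Bool)) (N₀ : ℕ) (x : List Bool) (H : ℕ)
    [NeZero H] (m : ℕ) : Matrix (Fin m) (Fin (H * H)) Bool := fun i j =>
  (decide (x.length < N₀) && decide (x ∈ L)) || (!decide (x.length < N₀) && V.entry x H i j)

theorem reduction_of_lt [NeZero H] (h : x.length < N₀) [Decidable (x ∈ L)] :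
    V.reduction L N₀ x H m = fun _ _ => decide (x ∈ L) := by
  ext i j
  simp [reduction, h]

theorem reduction_of_le [NeZero H] (h : N₀ ≤ x.length) :
    V.reduction L N₀ x H m = V.matrix x H m := by
  ext i j
  simp [reduction, matrix, h.not_gt]

theorem hasExactSparse_reduction [NeZero H] (hF : V.FitsIn x H) (hf : V.Functionality)
    (hC : V.PerfectCompleteness L) (hx : x ∈ L) :
    HasExactSparse (V.reduction L N₀ x H m) (2 * H) := by
  classical
  have hH := Nat.pos_of_neZero H
  rcases lt_or_ge x.length N₀ with hN | hN
  · rw [reduction_of_lt hN, decide_eq_true hx]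
    exact (hasExactSparse_true (Nat.mul_pos hH hH)).mono (k' := 2 * H) (by lia)
  · obtain ⟨P₁, P₂, hP⟩ := hC x hx
    rw [reduction_of_le hN]
    exact hasExactSparse_matrix hF hf hP

theorem onlyDense_reduction [NeZero H] (hF : V.FitsIn x H) (hU : V.Uniformity) (hx : x ∉ L)
    (hm : H ^ 10 = m) {K : ℝ} (hK : N₀ ≤ x.length → ∀ P₁ P₂, V.value x P₁ P₂ < 1 / K ^ 2) :
    OnlyDense (V.reduction L N₀ x H m) (H * H : ℕ) (K * H) := by
  classical
  rcases lt_or_ge x.length N₀ with hN | hN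
  · have hlt : H * H < m := by
      rw [← hm, ← sq]
      exact Nat.pow_lt_pow_right hF.two_le (by norm_num)
    rw [reduction_of_lt hN, decide_eq_false hx]
    exact onlyDense_false (Nat.cast_lt.2 hlt) (K * H)
  · rw [reduction_of_le hN]
    intro y hy
    by_contra! hlt
    obtain ⟨P₁, P₂, hP⟩ := exists_value_ge_of_norm_sq_le hF hU hm hy hlt.le
    exact (hK hN P₁ P₂).not_ge hP

theorem Efficient.encodeMatrix_reduction {α : Type} {Γ : Context α} {X : α → List Bool}
    {H m : α → ℕ} [∀ a, NeZero (H a)] (hV : V.Efficient) (L : Set (List Bool)) (N₀ : ℕ)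
    (hX : PolyTimeFrom Γ [X]) (hH : PolyTimeFrom Γ [fun a => unary (H a)])
    (hm : PolyTimeFrom Γ [fun a => unary (m a)]) :
    PolyTimeFrom Γ [fun a => encodeMatrix (V.reduction L N₀ (X a) (H a) (m a))] := by
  classical
  have hshort : PolyTimeFrom Γ [fun a => [decide ((X a).length < N₀)]] :=
    hX.unary_length.decide_lt (.unary_const N₀)
  have htable : PolyTimeFrom Γ
      [fun a => [decide ((X a).length < N₀) && decide (X a ∈ L)]] :=
    hX.length_lt_and (fun x => decide (x ∈ L)) N₀
  have hentry : PolyTimeFrom Γ.withIndex.withIndex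
      [fun b => [V.entry (X b.1.1) (H b.1.1) b.1.2 b.2]] :=
    hV.entry hX.weaken.weaken hH.weaken.weaken PolyTimeFrom.index.weaken .index
  exact .encodeMatrix_of_entry
    (B := fun a i j => (decide ((X a).length < N₀) && decide (X a ∈ L)) ||
      (!decide ((X a).length < N₀) && V.entry (X a) (H a) i j)) hm (hH.unary_mul hH)
    (htable.weaken.weaken.or (hshort.weaken.weaken.not.and hentry))

theorem Efficient.mem_BPP {ε : ℕ → ℝ} {σ : ℕ → ℝ} {η : Polynomial ℕ} {p₀ : ℕ}
    (hE : V.Efficient) (hC : V.PerfectCompleteness L) (hS : V.SoundnessError L ε)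
    (hf : V.Functionality) (hU : V.Uniformity) (hF : ∀ x, V.FitsIn x (η.eval x.length))
    (hη : ∀ N, p₀ ≤ η.eval N) (hσ : ∀ p, 0 ≤ σ p)
    (hε : ∀ᶠ N in Filter.atTop, ε N < 1 / (3 * σ (η.eval N * η.eval N)) ^ 2)
    (hdist : BPPDistinguishable (sparseCase (.X ^ 5) (fun p => 2 * Nat.sqrt p + 1) p₀)
      (denseCase (.X ^ 5) (fun p => 2 * Nat.sqrt p + 1) σ Nat.cast p₀)) : L ∈ BPP := by
  obtain ⟨N₀, hN₀⟩ := Filter.eventually_atTop.1 hε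
  let H (x : List Bool) := η.eval x.length
  let M (x : List Bool) := (Polynomial.X ^ 5).eval (H x * H x)
  have hne (x : List Bool) : NeZero (H x) := ⟨(zero_lt_two.trans_le (hF x).two_le).ne'⟩
  have hM (x : List Bool) : H x ^ 10 = M x := by
    simp only [M, Polynomial.eval_pow, Polynomial.eval_X]
    ring
  have hp₀ (x : List Bool) : p₀ ≤ H x * H x := (hη _).trans (Nat.le_mul_self _)
  have hX : PolyTimeFrom [id] [fun x : List Bool => x] := .of_mem (List.mem_singleton.2 rfl)
  have hH : PolyTimeFrom [id] [fun x => unary (H x)] := hX.unary_length.unary_eval η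
  refine hdist.of_reduction (e := fun x => encodeMatrix (V.reduction L N₀ x (H x) (M x)))
    (hE.encodeMatrix_reduction L N₀ hX hH ((hH.unary_mul hH).unary_eval _)).polyTime
    (ℓ := (η * η) ^ 5 + 1 + η * η + 1 + (η * η) ^ 5 * (η * η))
    (fun x => ?_) (fun x hx => ?_) (fun x hx => ?_)
  · simp [length_encodeMatrix, M, H]
  · refine ⟨_, _, hp₀ x, rfl, (hasExactSparse_reduction (hF x) hf hC hx).mono ?_⟩
    change 2 * H x ≤ 2 * Nat.sqrt (H x * H x) + 1
    rw [Nat.sqrt_eq]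
    exact Nat.le_succ _
  · refine ⟨_, _, hp₀ x, rfl, (onlyDense_reduction (hF x) hU hx (hM x)
      fun hN P₁ P₂ => (hS x hx P₁ P₂).trans_lt (hN₀ _ hN)).mono ?_⟩
    have hH1 : (1 : ℝ) ≤ H x := mod_cast Nat.pos_of_neZero (H x)
    change ((2 * Nat.sqrt (H x * H x) + 1 : ℕ) : ℝ) * σ (H x * H x) ≤ 3 * σ (H x * H x) * H x
    rw [Nat.sqrt_eq]
    push_cast
    nlinarith [hσ (H x * H x)]

end Verifier

/-! ## Parameters -/

theorem add_le_pow_add_add_one {M a b : ℝ} {k l : ℕ} (hM : 2 ≤ M) (ha : a ≤ M ^ k)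
    (hb : b ≤ M ^ l) : a + b ≤ M ^ (k + l + 1) := by
  have hk : M ^ k ≤ M ^ (k + l) := pow_le_pow_right₀ (by linarith) (by lia)
  have hl : M ^ l ≤ M ^ (k + l) := pow_le_pow_right₀ (by linarith) (by lia)
  calc
    a + b ≤ M ^ (k + l) * 2 := by linarith
    _ ≤ M ^ (k + l + 1) := by
      rw [pow_succ]
      gcongr

theorem natCast_le_pow {M : ℝ} (hM : 2 ≤ M) (d : ℕ) : (d : ℝ) ≤ M ^ d :=
  calc
    (d : ℝ) ≤ 2 ^ d := mod_cast Nat.lt_two_pow_self.le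
    _ ≤ M ^ d := by gcongr

theorem exists_add_rpow_pow_add_le_pow {c : ℝ} (hc : 0 ≤ c) (d : ℕ) :
    ∃ f : ℕ, ∀ M s t : ℝ, 2 ≤ M → 0 ≤ s → s ≤ M → 0 ≤ t → t ≤ M →
      (s + t ^ c) ^ d + d ≤ M ^ f := by
  refine ⟨(1 + ⌈c⌉₊ + 1) * d + d + 1, fun M s t hM hs hsM ht htM => ?_⟩
  have hrpow : t ^ c ≤ M ^ ⌈c⌉₊ :=
    calc
      t ^ c ≤ M ^ c := by gcongr
      _ ≤ M ^ (⌈c⌉₊ : ℝ) := Real.rpow_le_rpow_of_exponent_le (by linarith) (Nat.le_ceil c)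
      _ = M ^ ⌈c⌉₊ := Real.rpow_natCast _ _
  refine add_le_pow_add_add_one hM ?_ (natCast_le_pow hM d)
  rw [pow_mul]
  gcongr
  exact add_le_pow_add_add_one hM (by simpa using hsM) hrpow

theorem BiregularPGC.exists_verifier (h : BiregularPGC) :
    ∃ (c : ℝ) (g : ℕ) (V : Verifier), 0 < c ∧ 0 < g ∧ V.Efficient ∧ V.PerfectCompleteness SAT ∧
      V.SoundnessError SAT (fun N => (2 / ((N : ℝ) + 1)) ^ c) ∧ V.Functionality ∧ V.Uniformity ∧
      ∀ h : ℕ, 2 ≤ h → ∀ x, V.FitsIn x ((x.length + h) ^ g) := by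
  obtain ⟨c, hc, d, hverifier⟩ := h
  obtain ⟨V, hE, hC, hS, hB, hf, hU⟩ := hverifier (fun N => (2 / ((N : ℝ) + 1)) ^ c) fun N => by
    -- `2 / (N + 1)` is at least `1 / N` for `0 < N` and, unlike the latter, positive at `N = 0`.
    refine ⟨by positivity, ?_⟩
    rcases N.eq_zero_or_pos with rfl | hN
    · rw [Nat.cast_zero, Real.zero_rpow hc.ne', div_zero]
      positivity
    · have hN1 : (1 : ℝ) ≤ N := mod_cast hN
      rw [one_div, ← Real.inv_rpow (by positivity), inv_eq_one_div]
      gcongr ?_ ^ c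
      rw [div_le_div_iff₀ (by positivity) (by positivity)]
      linarith
  obtain ⟨f, hpow⟩ := exists_add_rpow_pow_add_le_pow hc.le d
  refine ⟨c, f + f + 1, V, hc, Nat.succ_pos _, hE, hC, hS, hf, hU, fun h hh x => ?_⟩
  have hM : (2 : ℝ) ≤ ((x.length + h : ℕ) : ℝ) := mod_cast hh.trans (Nat.le_add_left _ _)
  have hh2 : (2 : ℝ) ≤ h := mod_cast hh
  have hsize : ((x.length : ℝ) + 1 / (2 / ((x.length : ℝ) + 1)) ^ c) ^ d + d ≤
      ((x.length + h : ℕ) : ℝ) ^ f := by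
    rw [one_div, ← Real.inv_rpow (by positivity), inv_div]
    refine hpow _ _ _ hM (by positivity) ?_ (by positivity) ?_
    · push_cast
      linarith
    · push_cast
      linarith
  obtain ⟨hR, hQ₁, hQ₂, hA₁, hA₂⟩ := hB x
  have hle {n : ℕ} (hn : (n : ℝ) ≤ ((x.length + h : ℕ) : ℝ) ^ f) :
      n ≤ (x.length + h) ^ (f + f + 1) :=
    mod_cast hn.trans (pow_le_pow_right₀ (by linarith) (by lia))
  exact ⟨hle (hR.trans hsize), hle (hQ₁.trans hsize), hle (hQ₂.trans hsize),
    mod_cast add_le_pow_add_add_one hM (hA₁.trans hsize) (hA₂.trans hsize)⟩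

theorem sq_pow_mul_pow_rpow {M : ℝ} (hM : 0 ≤ M) {g : ℕ} (hg : 0 < g) (c : ℝ) :
    ((M ^ g * M ^ g) ^ (c / (8 * g))) ^ 2 = M ^ (c / 2) := by
  have hg' : (g : ℝ) ≠ 0 := mod_cast hg.ne'
  rw [← pow_add, ← Real.rpow_natCast, ← Real.rpow_natCast, ← Real.rpow_mul hM,
    ← Real.rpow_mul hM]
  congr 1
  push_cast
  field_simp
  ring

theorem div_rpow_mul_mul_rpow {t : ℝ} (ht : 0 < t) (c : ℝ) :
    (2 / t) ^ c * (2 * t) ^ (c / 2) = (8 / t) ^ (c / 2) := by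
  have hsq : (2 / t) ^ c = ((2 / t) ^ 2) ^ (c / 2) := by
    rw [← Real.rpow_natCast, ← Real.rpow_mul (by positivity)]
    congr 1
    push_cast
    ring
  rw [hsq, ← Real.mul_rpow (by positivity) (by positivity)]
  congr 1
  field_simp
  norm_num

theorem tendsto_const_div_add_one_rpow {c : ℝ} (hc : 0 < c) (b : ℝ) :
    Filter.Tendsto (fun N : ℕ => (b / ((N : ℝ) + 1)) ^ c) Filter.atTop (nhds 0) := by
  have hdiv : Filter.Tendsto (fun N : ℕ => b / ((N : ℝ) + 1)) Filter.atTop (nhds 0) :=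
    (Filter.tendsto_atTop_add_const_right _ _ tendsto_natCast_atTop_atTop).const_div_atTop b
  simpa only [Real.zero_rpow hc.ne'] using hdiv.rpow_const (.inr hc.le)

theorem eventually_two_div_rpow_lt {c : ℝ} (hc : 0 < c) (h : ℕ) {g : ℕ} (hg : 0 < g) :
    ∀ᶠ N : ℕ in Filter.atTop, (2 / ((N : ℝ) + 1)) ^ c <
      1 / (3 * (((N + h) ^ g * (N + h) ^ g : ℕ) : ℝ) ^ (c / (8 * g))) ^ 2 := by
  filter_upwards [(tendsto_const_div_add_one_rpow (half_pos hc) 8).eventually_lt_const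
    (show (0 : ℝ) < 1 / 9 by norm_num), Filter.eventually_gt_atTop h] with N hN hhN
  have hh : (h : ℝ) < N := mod_cast hhN
  have hN0 : (0 : ℝ) < N := h.cast_nonneg.trans_lt hh
  push_cast
  rw [mul_pow, sq_pow_mul_pow_rpow (by positivity) hg, lt_div_iff₀ (by positivity)]
  calc
    (2 / ((N : ℝ) + 1)) ^ c * (3 ^ 2 * ((N : ℝ) + h) ^ (c / 2))
      ≤ (2 / ((N : ℝ) + 1)) ^ c * (3 ^ 2 * (2 * ((N : ℝ) + 1)) ^ (c / 2)) := by
        gcongr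
        linarith
    _ = 3 ^ 2 * (8 / ((N : ℝ) + 1)) ^ (c / 2) := by
        rw [mul_left_comm, div_rpow_mul_mul_rpow (by positivity)]
    _ < 1 := by linarith

theorem polyGrowth_rpow {c : ℝ} (hc : 0 < c) : PolyGrowth fun p => (p : ℝ) ^ c :=
  ⟨c, hc, .of_forall fun _ => le_rfl⟩

end SparseReg

open SparseReg in
theorem mainTheorem9 (hPGC : SparseReg.BiregularPGC) :
    ∃ σ Δ : ℕ → ℝ, SparseReg.PolyGrowth σ ∧ SparseReg.PolyGrowth Δ ∧
      (SparseReg.SAT ∉ SparseReg.BPP →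
        ∃ (m : Polynomial ℕ) (k : ℕ → ℕ),
          (∀ p, 0 < k p) ∧
          SparseReg.PolyTime (fun p : ℕ => [SparseReg.unary p])
            (fun p => SparseReg.unary (k p)) ∧
          ∀ p₀ : ℕ, ¬ SparseReg.BPPDistinguishable
            (SparseReg.sparseCase m k p₀) (SparseReg.denseCase m k σ Δ p₀)) := by
  obtain ⟨c, g, V, hc, hg, hE, hC, hS, hf, hU, hF⟩ := hPGC.exists_verifier
  refine ⟨fun p => (p : ℝ) ^ (c / (8 * g)), Nat.cast, polyGrowth_rpow (by positivity),
    by simpa using polyGrowth_rpow one_pos, fun hSAT => ⟨.X ^ 5, fun p => 2 * Nat.sqrt p + 1,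
      fun _ => Nat.succ_pos _, ?_, fun p₀ hdist => hSAT ?_⟩⟩
  · have hp : PolyTimeFrom [unary] [fun p => unary p] := .of_mem (List.mem_singleton_self _)
    exact (((PolyTimeFrom.unary_const 2).unary_mul hp.unary_sqrt).unary_add
      (.unary_const 1)).polyTime
  · have hη (N : ℕ) : ((.X + .C (p₀ + 2)) ^ g : Polynomial ℕ).eval N = (N + (p₀ + 2)) ^ g := by
      simp
    refine hE.mem_BPP (η := (.X + .C (p₀ + 2)) ^ g) hC hS hf hU
      (fun x => hη x.length ▸ hF (p₀ + 2) (by lia) x) (fun N => ?_) (fun p => by positivity) ?_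
      hdist
    · rw [hη]
      exact le_trans (by lia) (Nat.le_self_pow hg.ne' _)
    · simpa only [hη] using eventually_two_div_rpow_lt hc (p₀ + 2) hg
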